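/- Let $M$ be a smooth manifold of dimension $2n+1\ge 5$ with an almost paracontact metric structure $(\varphi,\xi,\eta,g)$: $\varphi$ is a smooth $(1,1)$-tensor field, $\xi$ a smooth vector field, $\eta$ a smooth 1-form with $\varphi\xi=0$, $\eta\circ\varphi=0$, $\eta(\xi)=1$, $\varphi^2=\mathrm{id}-\eta\otimes\xi$, the eigenspaces of $\varphi|_{\ker\eta}$ for the eigenvalues $\pm1$ both have dimension $n$, and $g$ is a smooth pseudo-Riemannian metric with $g(\varphi X,\varphi Y)=-g(X,Y)+\eta(X)\eta(Y)$. The structure is paracontact if $g(X,\varphi Y)=d\eta(X,Y)$, where $d\eta(X,Y)=\frac12\big(X\eta(Y)-Y\eta(X)-\eta([X,Y])\big)$; it is paraSasakian if moreover it is normal, i.e. the Nijenhuis tensor $N_J(U,V)=[JU,JV]-J[JU,V]-J[U,JV]+[U,V]$ of the endomorphism $J(X,f\frac{d}{dt})=(\varphi X+f\xi,\ \eta(X)\frac{d}{dt})$ on $M\times\mathbb R$ vanishes. Let $\nabla$ be the Levi-Civita connection of $g$, $R(X,Y)Z=\nabla_X\nabla_YZ-\nabla_Y\nabla_XZ-\nabla_{[X,Y]}Z$,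 $\mathrm{Ric}(Y,Z)=\mathrm{tr}\,(X\mapsto R(X,Y)Z)$, and let $\mathrm{scal}$ be the $g$-trace of $\mathrm{Ric}$. Put $h=\frac12\mathcal L_\xi\varphi$ and $P_{rsi}=\nabla_r\varphi_{si}-\eta_ig_{rs}+\eta_sg_{ri}$ with $\varphi_{si}=g_{sk}\varphi^k_i$, and write $|P(X)|^2=P_{rsi}P^{rs}{}_jX^iX^j$ and $|h(X)|^2=g(hX,hX)$. Suppose that $(M,g)$ is locally conformally flat: every point has an open neighbourhood $U$ with a positive smooth function $u$ on $U$ such that the metric $u\,g$ on $U$ has zero curvature. (1) If the structure is paracontact, then for every point and every tangent vector $X$ there with $g(X,X)=1$ and $g(X,\xi)=0$, $$\mathrm{Ric}(X,X)-\mathrm{Ric}(\varphi X,\varphi X)=-4n-\frac{1}{n(2n-3)}\big(2n(2n+1)+\mathrm{scal}\big)+\frac{2n-1}{2n-3}\big(|P(X)|^2+|h(X)|^2\big).$$ (2) If the structure is paraSasakian, then for every such $X$, $$\mathrm{Ric}(X,X)-\mathrm{Ric}(\varphi X,\varphi X)=-4n-\frac{1}{n(2n-3)}\big(2n(2n+1)+\mathrm{scal}\big).$$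 -/

import Mathlib

open scoped Manifold ContDiff
open VectorField

noncomputable section

namespace Paracontact

/-- The model space `ℝ^m`. -/
abbrev E (m : ℕ) : Type := EuclideanSpace ℝ (Fin m)

/-! ### Tensor calculus on open subsets of `ℝ^m`

All tensor fields are given by functions on `ℝ^m`; only their germs at the point `y` matter.
Vectors `u v w z` stand for the constant vector fields with these values, whose Lie brackets
vanish. -/

section Local

variable {m : ℕ}

/-- The `i`-th coordinate vector. -/
def basisVec (i : Fin m) : E m := EuclideanSpace.single i (1 : ℝ)

/-- The matrix `g^{ij}` inverse to `g_{ij} = g(∂_i, ∂_j)`. -/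
def inverseMetric (g : E m → E m →L[ℝ] E m →L[ℝ] ℝ) (y : E m) : Matrix (Fin m) (Fin m) ℝ :=
  (Matrix.of fun i j => g y (basisVec i) (basisVec j))⁻¹

/-- The Levi-Civita connection term `Γ(v, w) = Γ^k_{ij} v^i w^j ∂_k`, where
`Γ^k_{ij} = ½ g^{kl} (∂_i g_{jl} + ∂_j g_{il} - ∂_l g_{ij})`. -/
def christoffel (g : E m → E m →L[ℝ] E m →L[ℝ] ℝ) (y v w : E m) : E m :=
  ∑ k, (∑ l, inverseMetric g y k l *
    ((fderiv ℝ g y v w (basisVec l) + fderiv ℝ g y w v (basisVec l)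
      - fderiv ℝ g y (basisVec l) v w) / 2)) • basisVec k

/-- The Levi-Civita covariant derivative `∇_v W` at `y` of a vector field `W`. -/
def covDeriv (g : E m → E m →L[ℝ] E m →L[ℝ] ℝ) (y v : E m) (W : E m → E m) : E m :=
  fderiv ℝ W y v + christoffel g y v (W y)

/-- The curvature `R(v, w)z = ∇_v ∇_w z - ∇_w ∇_v z - ∇_{[v, w]} z`; here `[v, w] = 0`. -/
def curvature (g : E m → E m →L[ℝ] E m →L[ℝ] ℝ) (y v w z : E m) : E m :=
  covDeriv g y v (fun x => covDeriv g x w fun _ => z)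
    - covDeriv g y w (fun x => covDeriv g x v fun _ => z)

/-- The Ricci tensor `Ric(v, w) = trace (u ↦ R(u, v)w)`. -/
def ricciLocal (g : E m → E m →L[ℝ] E m →L[ℝ] ℝ) (y v w : E m) : ℝ :=
  ∑ i, (curvature g y (basisVec i) v w) i

/-- The scalar curvature `g^{ij} Ric_{ij}`. -/
def scalLocal (g : E m → E m →L[ℝ] E m →L[ℝ] ℝ) (y : E m) : ℝ :=
  ∑ i, ∑ j, inverseMetric g y i j * ricciLocal g y (basisVec i) (basisVec j)

/-- The covariant derivative `(∇_v φ)w = ∇_v (φ w) - φ (∇_v w)` of a `(1,1)`-tensor field. -/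
def covDerivEnd (g : E m → E m →L[ℝ] E m →L[ℝ] ℝ) (φ : E m → E m →L[ℝ] E m)
    (y v w : E m) : E m :=
  covDeriv g y v (fun x => φ x w) - φ y (covDeriv g y v fun _ => w)

/-- `dη(v, w) = ½ (v η(w) - w η(v) - η([v, w]))`, with the factor `½`. -/
def dOneForm (η : E m → E m →L[ℝ] ℝ) (y v w : E m) : ℝ :=
  (fderiv ℝ η y v w - fderiv ℝ η y w v) / 2

/-- `h = ½ 𝓛_ξ φ`, that is `h v = ½ ([ξ, φ v] - φ [ξ, v])`. -/
def hLocal (φ : E m → E m →L[ℝ] E m) (ξ : E m → E m) (y v : E m) : E m :=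
  (1 / 2 : ℝ) • (lieBracket ℝ ξ (fun x => φ x v) y - φ y (lieBracket ℝ ξ (fun _ => v) y))

/-- The tensor `P(u, w; v) = g((∇_u φ)v, w) - η(v) g(u, w) + η(w) g(u, v)`,
i.e. `P_{rsi} = ∇_r φ_{si} - η_i g_{rs} + η_s g_{ri}` with `φ_{si} = g_{sk} φ^k_i`,
contracted with `u^r w^s v^i`. -/
def pTensor (g : E m → E m →L[ℝ] E m →L[ℝ] ℝ) (φ : E m → E m →L[ℝ] E m)
    (η : E m → E m →L[ℝ] ℝ) (y u w v : E m) : ℝ :=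
  g y (covDerivEnd g φ y u v) w - η y v * g y u w + η y w * g y u v

/-- `|P(v)|² = P_{rsi} P^{rs}_j v^i v^j`, indices being raised with `g`. -/
def pNormSqLocal (g : E m → E m →L[ℝ] E m →L[ℝ] ℝ) (φ : E m → E m →L[ℝ] E m)
    (η : E m → E m →L[ℝ] ℝ) (y v : E m) : ℝ :=
  ∑ r, ∑ s, ∑ a, ∑ b, inverseMetric g y r a * inverseMetric g y s b *
    pTensor g φ η y (basisVec r) (basisVec s) v * pTensor g φ η y (basisVec a) (basisVec b) v

/-- The endomorphism `J(X, f ∂_t) = (φ X + f ξ, η(X) ∂_t)` on the product with the real line. -/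
def productJ (φ : E m → E m →L[ℝ] E m) (ξ : E m → E m) (η : E m → E m →L[ℝ] ℝ)
    (x u : E m × ℝ) : E m × ℝ :=
  (φ x.1 u.1 + u.2 • ξ x.1, η x.1 u.1)

end Local

/-- The Nijenhuis tensor `N_J(u, w) = [Ju, Jw] - J[Ju, w] - J[u, Jw] + [u, w]` of a field of
endomorphisms with `J² = id` on a normed space, evaluated on constant vector fields. -/
def nijenhuis {V : Type*} [NormedAddCommGroup V] [NormedSpace ℝ V] (J : V → V → V)
    (x u w : V) : V :=
  lieBracket ℝ (fun z => J z u) (fun z => J z w) x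
    - J x (lieBracket ℝ (fun z => J z u) (fun _ => w) x)
    - J x (lieBracket ℝ (fun _ => u) (fun z => J z w) x)
    + lieBracket ℝ (fun _ => u) (fun _ => w) x

/-! ### Coordinate expressions of tensor fields on a manifold -/

section Coordinates

variable {m : ℕ} {M : Type*} [TopologicalSpace M] [ChartedSpace (E m) M]

/-- For a chart `e`, the linear map `ℝ^m → T_{e⁻¹ y} M` sending the `i`-th basis vector to the
coordinate vector field `∂_i`. -/
def frame (e : OpenPartialHomeomorph M (E m)) (y : E m) :
    E m →L[ℝ] TangentSpace (𝓡 m) (e.symm y) :=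
  mfderiv (𝓡 m) (𝓡 m) e.symm y

/-- The components in the chart `e` of tangent vectors at `p`. -/
def components (e : OpenPartialHomeomorph M (E m)) (p : M) :
    TangentSpace (𝓡 m) p →L[ℝ] E m :=
  mfderiv (𝓡 m) (𝓡 m) e p

/-- Coordinate expression of a vector field in the chart `e`. -/
def vecRep (ξ : ∀ p : M, TangentSpace (𝓡 m) p) (e : OpenPartialHomeomorph M (E m)) (y : E m) :
    E m :=
  components e (e.symm y) (ξ (e.symm y))

/-- Coordinate expression of a 1-form in the chart `e`. -/
def formRep (η : ∀ p : M, TangentSpace (𝓡 m) p →L[ℝ] ℝ) (e : OpenPartialHomeomorph M (E m))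
    (y : E m) : E m →L[ℝ] ℝ :=
  (η (e.symm y)).comp (frame e y)

/-- Coordinate expression of a `(1,1)`-tensor field in the chart `e`. -/
def endRep (φ : ∀ p : M, TangentSpace (𝓡 m) p →L[ℝ] TangentSpace (𝓡 m) p)
    (e : OpenPartialHomeomorph M (E m)) (y : E m) : E m →L[ℝ] E m :=
  (components e (e.symm y)).comp ((φ (e.symm y)).comp (frame e y))

/-- Coordinate expression of a `(0,2)`-tensor field in the chart `e`. -/
def bilinRep (g : ∀ p : M, TangentSpace (𝓡 m) p →L[ℝ] TangentSpace (𝓡 m) p →L[ℝ] ℝ)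
    (e : OpenPartialHomeomorph M (E m)) (y : E m) : E m →L[ℝ] E m →L[ℝ] ℝ :=
  (ContinuousLinearMap.precomp ℝ (frame e y)).comp ((g (e.symm y)).comp (frame e y))

/-- A pseudo-Riemannian metric `g` on `M` is locally conformally flat: around every point there
is a positive smooth function `u` such that `u g` has vanishing curvature. -/
def IsLocallyConformallyFlat
    (g : ∀ p : M, TangentSpace (𝓡 m) p →L[ℝ] TangentSpace (𝓡 m) p →L[ℝ] ℝ) : Prop :=
  ∀ p : M, ∃ U : Set M, IsOpen U ∧ p ∈ U ∧ ∃ u : M → ℝ,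
    ContMDiffOn (𝓡 m) 𝓘(ℝ, ℝ) ∞ u U ∧ (∀ q ∈ U, 0 < u q) ∧
    ∀ e ∈ atlas (E m) M, ∀ y ∈ e.target, e.symm y ∈ U → ∀ v w z : E m,
      curvature (fun x => u (e.symm x) • bilinRep g e x) y v w z = 0

/-- The Ricci tensor of the pseudo-Riemannian metric `g`, computed in the preferred chart. -/
def ricci (g : ∀ p : M, TangentSpace (𝓡 m) p →L[ℝ] TangentSpace (𝓡 m) p →L[ℝ] ℝ)
    (p : M) (X Y : TangentSpace (𝓡 m) p) : ℝ :=
  ricciLocal (bilinRep g (chartAt (E m) p)) (chartAt (E m) p p)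
    (components (chartAt (E m) p) p X) (components (chartAt (E m) p) p Y)

/-- The scalar curvature of the pseudo-Riemannian metric `g`, computed in the preferred chart. -/
def scal (g : ∀ p : M, TangentSpace (𝓡 m) p →L[ℝ] TangentSpace (𝓡 m) p →L[ℝ] ℝ)
    (p : M) : ℝ :=
  scalLocal (bilinRep g (chartAt (E m) p)) (chartAt (E m) p p)

end Coordinates

/-- An almost paracontact metric structure `(φ, ξ, η, g)` on a `(2n+1)`-dimensional manifold. -/
structure AlmostParacontactMetric (n : ℕ) (M : Type*) [TopologicalSpace M]
    [ChartedSpace (E (2 * n + 1)) M] where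
  /-- the `(1,1)`-tensor field -/
  φ : ∀ p : M, TangentSpace (𝓡 (2 * n + 1)) p →L[ℝ] TangentSpace (𝓡 (2 * n + 1)) p
  /-- the characteristic vector field -/
  ξ : ∀ p : M, TangentSpace (𝓡 (2 * n + 1)) p
  /-- the 1-form -/
  η : ∀ p : M, TangentSpace (𝓡 (2 * n + 1)) p →L[ℝ] ℝ
  /-- the compatible pseudo-Riemannian metric -/
  g : ∀ p : M, TangentSpace (𝓡 (2 * n + 1)) p →L[ℝ] TangentSpace (𝓡 (2 * n + 1)) p →L[ℝ] ℝ
  smooth_φ : ∀ e ∈ atlas (E (2 * n + 1)) M, ContDiffOn ℝ ∞ (endRep φ e) e.target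
  smooth_ξ : ∀ e ∈ atlas (E (2 * n + 1)) M, ContDiffOn ℝ ∞ (vecRep ξ e) e.target
  smooth_η : ∀ e ∈ atlas (E (2 * n + 1)) M, ContDiffOn ℝ ∞ (formRep η e) e.target
  smooth_g : ∀ e ∈ atlas (E (2 * n + 1)) M, ContDiffOn ℝ ∞ (bilinRep g e) e.target
  φ_ξ : ∀ p, φ p (ξ p) = 0
  η_φ : ∀ p X, η p (φ p X) = 0
  η_ξ : ∀ p, η p (ξ p) = 1
  φ_sq : ∀ p X, φ p (φ p X) = X - η p X • ξ p
  /-- the `+1`-eigenspace of `φ` on `ker η` has dimension `n` -/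
  finrank_plus : ∀ p, Module.finrank ℝ
    ↥(Module.End.eigenspace (φ p).toLinearMap 1 ⊓ LinearMap.ker (η p).toLinearMap) = n
  /-- the `-1`-eigenspace of `φ` on `ker η` has dimension `n` -/
  finrank_minus : ∀ p, Module.finrank ℝ
    ↥(Module.End.eigenspace (φ p).toLinearMap (-1) ⊓ LinearMap.ker (η p).toLinearMap) = n
  g_symm : ∀ p X Y, g p X Y = g p Y X
  g_nondegenerate : ∀ p X, (∀ Y, g p X Y = 0) → X = 0
  g_φ_φ : ∀ p X Y, g p (φ p X) (φ p Y) = - g p X Y + η p X * η p Y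

namespace AlmostParacontactMetric

variable {n : ℕ} {M : Type*} [TopologicalSpace M] [ChartedSpace (E (2 * n + 1)) M]

/-- The structure is a paracontact metric structure: `g(X, φ Y) = dη(X, Y)`. -/
def IsParacontact (S : AlmostParacontactMetric n M) : Prop :=
  ∀ e ∈ atlas (E (2 * n + 1)) M, ∀ y ∈ e.target, ∀ v w : E (2 * n + 1),
    bilinRep S.g e y v (endRep S.φ e y w) = dOneForm (formRep S.η e) y v w

/-- The structure is normal: the almost paracomplex structure `J` on `M × ℝ` is integrable,
i.e. its Nijenhuis tensor vanishes (in the charts `e × id`). -/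
def IsNormal (S : AlmostParacontactMetric n M) : Prop :=
  ∀ e ∈ atlas (E (2 * n + 1)) M, ∀ y ∈ e.target, ∀ (t : ℝ) (u w : E (2 * n + 1) × ℝ),
    nijenhuis (productJ (endRep S.φ e) (vecRep S.ξ e) (formRep S.η e)) (y, t) u w = 0

/-- A paraSasakian structure is a normal paracontact metric structure. -/
def IsParaSasakian (S : AlmostParacontactMetric n M) : Prop :=
  S.IsParacontact ∧ S.IsNormal

/-- The components in the preferred chart of the tangent vector `hX`, where `h = ½ 𝓛_ξ φ`. -/
def hComponents (S : AlmostParacontactMetric n M) (p : M) (X : TangentSpace (𝓡 (2 * n + 1)) p) :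
    E (2 * n + 1) :=
  hLocal (endRep S.φ (chartAt (E (2 * n + 1)) p)) (vecRep S.ξ (chartAt (E (2 * n + 1)) p))
    (chartAt (E (2 * n + 1)) p p) (components (chartAt (E (2 * n + 1)) p) p X)

/-- `|h(X)|² = g(hX, hX)`. -/
def hNormSq (S : AlmostParacontactMetric n M) (p : M) (X : TangentSpace (𝓡 (2 * n + 1)) p) : ℝ :=
  bilinRep S.g (chartAt (E (2 * n + 1)) p) (chartAt (E (2 * n + 1)) p p)
    (S.hComponents p X) (S.hComponents p X)

/-- `|P(X)|² = P_{rsi} P^{rs}_j X^i X^j`, computed in the preferred chart. -/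
def pNormSq (S : AlmostParacontactMetric n M) (p : M) (X : TangentSpace (𝓡 (2 * n + 1)) p) : ℝ :=
  pNormSqLocal (bilinRep S.g (chartAt (E (2 * n + 1)) p))
    (endRep S.φ (chartAt (E (2 * n + 1)) p)) (formRep S.η (chartAt (E (2 * n + 1)) p))
    (chartAt (E (2 * n + 1)) p p) (components (chartAt (E (2 * n + 1)) p) p X)

end AlmostParacontactMetric

end Paracontact

end

/-!
The idea is a Bochner type computation for the fundamental form `Φ = g(·, φ ·) = dη`. Write
`N = ∇φ`, `A = ∇η` and let `R` be the curvature of `g`.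

* `Φ` is closed and the divergence of `φ` is `2n η` (`IsParacontactJet.sum_g_N`). Hence the rough
  Laplacian of `Φ` is obtained by commuting covariant derivatives in `∇^r ∇_k φ_{ri}`, and equals a
  multiple of `Φ` plus curvature terms: the Ricci curvature and a contraction of `R` with `φ`.
* Differentiating `φ² = id - η ⊗ ξ` twice and contracting at a unit vector `X ⊥ ξ` expresses the
  same Laplacian at `(X, φ X)` through `|∇φ (X)|²` and `|∇η (X)|²`
  (`IsParacontactOn.g_nablaSqEnd_φ`). The relation between `∇η` and `h` turns this into
  `2 + |P(X)|² + |h(X)|²` (`IsParacontactJet.sum_N_sub_sum_A`).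
* If `u g` is flat, comparing the two Levi-Civita connections shows
  `R(v, w)z = S(w, z) v - S(v, z) w + g(w, z) T v - g(v, z) T w` with `S = g(T ·, ·)` symmetric
  (`IsMetricOn.exists_curvature_eq_of_conformallyFlat`). Then `Ric = (2n - 1) S + (tr T) g` and
  `scal = 4n tr T`, so that all curvature terms are expressed by `Ric(X, X) - Ric(φ X, φ X)` and
  `scal`. Comparing the two values of the Laplacian gives the formula
  (`IsParacontactOn.ricciLocal_sub`).

In the paraSasakian case the mixed components of the Nijenhuis tensor say `h = 0`. The remaining
components, the closedness of `Φ` and the derivative of `φ² = id - η ⊗ ξ` are linear relations on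
`P`, which force `P = 0` (`IsParacontactJet.N_eq_of_normal`).

The identities which hold at a single point are collected in `IsParacontactJet` and used there as
linear algebra; the analysis takes place on open subsets of `ℝ^m`, in a chart.
-/

namespace Paracontact

/-! ### Contractions with respect to a nondegenerate symmetric form -/

section Frames

variable {ι V : Type*} [Fintype ι] [NormedAddCommGroup V] [NormedSpace ℝ V]

/-- Two families `e`, `f` are dual frames for `g` when `g(f a, ·)` are the coordinates with respect
to `e`, and vice versa. Contracting a bilinear form `B` with `g` then means forming
`∑ a, B (e a) (f a)`. -/
structure IsDualFrame (g : V →L[ℝ] V →L[ℝ] ℝ) (e f : ι → V) : Prop where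
  symm : ∀ x y, g x y = g y x
  sum_smul_left : ∀ x, ∑ a, g (f a) x • e a = x
  sum_smul_right : ∀ x, ∑ a, g (e a) x • f a = x
  sum_self : ∑ a, g (f a) (e a) = Fintype.card ι

namespace IsDualFrame

variable {g : V →L[ℝ] V →L[ℝ] ℝ} {e f : ι → V}

theorem sum_mul_left (F : IsDualFrame g e f) (L : V →ₗ[ℝ] ℝ) (x : V) :
    ∑ a, g (f a) x * L (e a) = L x := by
  conv_rhs => rw [← F.sum_smul_left x]
  simp [map_sum]

theorem sum_mul_right (F : IsDualFrame g e f) (L : V →ₗ[ℝ] ℝ) (x : V) :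
    ∑ a, g (e a) x * L (f a) = L x := by
  conv_rhs => rw [← F.sum_smul_right x]
  simp [map_sum]

theorem sum_inner_mul_inner (F : IsDualFrame g e f) (x y : V) :
    ∑ a, g x (e a) * g y (f a) = g x y := by
  have := F.sum_mul_left (g x).toLinearMap y
  simp only [ContinuousLinearMap.coe_coe] at this
  rw [← this]
  exact Finset.sum_congr rfl fun a _ => by rw [F.symm y (f a)]; ring

theorem sum_swap (F : IsDualFrame g e f) (B : V →ₗ[ℝ] V →ₗ[ℝ] ℝ) :
    ∑ a, B (e a) (f a) = ∑ a, B (f a) (e a) := by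
  have h1 : ∀ a, B (e a) (f a) = ∑ b, g (f b) (f a) * B (e a) (e b) := fun a =>
    (F.sum_mul_left (B (e a)) (f a)).symm
  have h2 : ∀ a, B (f a) (e a) = ∑ b, g (f b) (f a) * B (e b) (e a) := fun a =>
    (F.sum_mul_left (B.flip (e a)) (f a)).symm
  simp only [h1, h2]
  rw [Finset.sum_comm]
  exact Finset.sum_congr rfl fun b _ => Finset.sum_congr rfl fun a _ => by rw [F.symm]

theorem sum_adjoint (F : IsDualFrame g e f) (B : V →ₗ[ℝ] V →ₗ[ℝ] ℝ) {L L' : V → V}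
    (hL : ∀ x y, g (L x) y = g x (L' y)) :
    ∑ a, B (L (e a)) (f a) = ∑ a, B (e a) (L' (f a)) := by
  have h1 : ∀ a, B (L (e a)) (f a) = ∑ b, g (f b) (L (e a)) * B (e b) (f a) := fun a =>
    (F.sum_mul_left (B.flip (f a)) (L (e a))).symm
  have h2 : ∀ a, B (e a) (L' (f a)) = ∑ b, g (e b) (L' (f a)) * B (e a) (f b) := fun a =>
    (F.sum_mul_right (B (e a)) (L' (f a))).symm
  simp only [h1, h2]
  rw [Finset.sum_comm]
  exact Finset.sum_congr rfl fun b _ => Finset.sum_congr rfl fun a _ => by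
    rw [F.symm, hL]

/-- Contracting with a `g`-skew endomorphism only sees the alternating part of a form. -/
theorem sum_skew (F : IsDualFrame g e f) (B : V →ₗ[ℝ] V →ₗ[ℝ] ℝ) {L : V →L[ℝ] V}
    (hL : ∀ x y, g (L x) y = - g x (L y)) :
    ∑ a, B (e a) (L (f a)) = - ∑ a, B (L (f a)) (e a) := by
  have h1 := F.sum_adjoint B (L := fun x => L x) (L' := fun x => - L x) (by simpa using hL)
  have h2 := F.sum_swap (B.comp L.toLinearMap)
  simp only [LinearMap.comp_apply, ContinuousLinearMap.coe_coe, map_neg,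
    Finset.sum_neg_distrib] at h1 h2
  linarith

/-- The trace identity `tr (L M) = tr (M L)`. -/
theorem sum_trace_comm (F : IsDualFrame g e f) (L M : V →L[ℝ] V) :
    ∑ a, g (f a) (L (M (e a))) = ∑ a, g (f a) (M (L (e a))) := by
  have h : ∀ L M : V →L[ℝ] V, ∀ a,
      g (f a) (L (M (e a))) = ∑ b, g (f b) (M (e a)) * g (f a) (L (e b)) := fun L M a =>
    (F.sum_mul_left ((g (f a)).comp L).toLinearMap (M (e a))).symm
  simp only [h]
  rw [Finset.sum_comm]
  exact Finset.sum_congr rfl fun b _ => Finset.sum_congr rfl fun a _ => mul_comm _ _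

end IsDualFrame

end Frames

/-! ### Pointwise identities of paracontact metric structures -/

section Jet

variable {ι V : Type*} [Fintype ι] [NormedAddCommGroup V] [NormedSpace ℝ V]

/-- The values at one point of an almost paracontact metric structure `(φ, ξ, η, g)`, together with
`N = ∇φ` and `A = ∇η`, that is `N v w = (∇_v φ) w` and `A v w = (∇_v η) w`, and the first order
relations which hold between them on a paracontact metric manifold. -/
structure IsParacontactJet (g : V →L[ℝ] V →L[ℝ] ℝ) (φ : V →L[ℝ] V) (ξ : V) (η : V →L[ℝ] ℝ)
    (N : V →L[ℝ] V →L[ℝ] V) (A : V →L[ℝ] V →L[ℝ] ℝ) : Prop where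
  symm : ∀ x y, g x y = g y x
  nondegenerate : ∀ x, (∀ y, g x y = 0) → x = 0
  φ_ξ : φ ξ = 0
  η_φ : ∀ x, η (φ x) = 0
  η_ξ : η ξ = 1
  φ_sq : ∀ x, φ (φ x) = x - η x • ξ
  g_φ_φ : ∀ x y, g (φ x) (φ y) = - g x y + η x * η y
  skew : ∀ v s i, g s (N v i) = - g i (N v s)
  /-- the fundamental form `g(·, φ ·) = dη` is closed -/
  cyclic : ∀ v s i, g s (N v i) + g i (N s v) + g v (N i s) = 0
  /-- the covariant derivative of `g(s, φ² i) = g(s, i) - η(s) η(i)` -/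
  deriv_φ_sq : ∀ v s i, g s (N v (φ i)) - g (φ s) (N v i) = - (A v s * η i) - η s * A v i
  A_ξ : ∀ v, A v ξ = 0
  /-- the paracontact condition `dη = g(·, φ ·)` -/
  A_alt : ∀ v s, A v s - A s v = 2 * g v (φ s)

namespace IsParacontactJet

variable {g : V →L[ℝ] V →L[ℝ] ℝ} {φ : V →L[ℝ] V} {ξ : V} {η : V →L[ℝ] ℝ}
  {N : V →L[ℝ] V →L[ℝ] V} {A : V →L[ℝ] V →L[ℝ] ℝ}

theorem g_ξ (J : IsParacontactJet g φ ξ η N A) (x : V) : g x ξ = η x := by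
  have := J.g_φ_φ x ξ
  rw [J.φ_ξ, J.η_ξ, map_zero] at this
  linarith

theorem g_φ_left (J : IsParacontactJet g φ ξ η N A) (x y : V) : g (φ x) y = - g x (φ y) := by
  have := J.g_φ_φ x (φ y)
  rw [J.φ_sq, J.η_φ, map_sub, map_smul, J.g_ξ, J.η_φ] at this
  simpa using this

theorem A_ξ_left (J : IsParacontactJet g φ ξ η N A) (s : V) : A ξ s = 0 := by
  have h := J.A_alt ξ s
  rw [J.A_ξ, J.symm, J.g_ξ, J.η_φ] at h
  linarith

theorem g_N_ξ (J : IsParacontactJet g φ ξ η N A) (v s : V) : g s (N v ξ) = A v (φ s) := by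
  have h1 := J.deriv_φ_sq v (φ s) ξ
  have h2 := J.skew v ξ ξ
  rw [J.φ_ξ, J.φ_sq, J.η_φ, J.η_ξ] at h1
  simp only [map_zero, map_sub, map_smul, sub_apply,
    smul_apply, smul_eq_mul] at h1
  have h3 : g ξ (N v ξ) = 0 := by linarith
  rw [h3] at h1
  linarith

/-- The symmetric part `½ 𝓛_ξ g` of `∇η` is `φ`-invariant. -/
theorem symmPart_φ_φ (J : IsParacontactJet g φ ξ η N A) (s i : V) :
    A (φ s) (φ i) - g (φ s) (φ (φ i)) = A s i - g s (φ i) := by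
  -- The form `g(s, (∇_ξ φ) i)` expressed through `∇η` by closedness.
  have hF : ∀ s i, g s (N ξ i) = - A s (φ i) + A i (φ s) := fun s i => by
    have h1 := J.cyclic ξ s i
    have h2 := J.skew i ξ s
    have h3 := J.g_N_ξ s i
    have h4 := J.g_N_ξ i s
    linarith
  have h := J.deriv_φ_sq ξ s i
  simp only [hF, J.φ_sq, map_sub, map_smul, smul_eq_mul, J.A_ξ, J.A_ξ_left] at h
  have h1 := J.A_alt s i
  have h2 := J.A_alt (φ s) (φ i)
  have h3 := J.g_φ_φ s (φ i)
  rw [J.η_φ] at h3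
  rw [h3] at h2 ⊢
  linarith

theorem symmPart_φ_left (J : IsParacontactJet g φ ξ η N A) (s i : V) :
    A (φ s) i - g (φ s) (φ i) = A s (φ i) - g s (φ (φ i)) := by
  have h := J.symmPart_φ_φ s (φ i)
  simp only [J.φ_sq, map_sub, map_smul, smul_eq_mul, J.φ_ξ, J.A_ξ, map_zero] at h ⊢
  linarith

theorem N_ξ_left (J : IsParacontactJet g φ ξ η N A) (i : V) : N ξ i = 0 := by
  refine J.nondegenerate _ fun s => ?_
  rw [J.symm]
  have h1 := J.cyclic ξ s i
  have h2 := J.skew i ξ s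
  have h3 := J.g_N_ξ s i
  have h4 := J.g_N_ξ i s
  have h5 := J.symmPart_φ_left s i
  have h6 := J.A_alt (φ s) i
  have h7 := J.g_φ_φ s i
  have h8 : g s (φ (φ i)) = - g (φ s) (φ i) := by rw [J.g_φ_left]; ring
  linarith

/-- `h = ½ 𝓛_ξ φ` is determined by the symmetric part of `∇η`; the hypothesis is the formula for
`h` through the Levi-Civita connection. -/
theorem A_eq_of_h (J : IsParacontactJet g φ ξ η N A) {X h : V}
    (hh : ∀ z, g h z = (g z (N ξ X) - A (φ X) z - A X (φ z)) / 2) (r : V) :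
    A r X = g r (φ (X + h)) := by
  have h1 := hh (φ r)
  rw [J.N_ξ_left, map_zero, J.φ_sq, map_sub, map_smul, J.A_ξ] at h1
  have h2 := J.symmPart_φ_φ X r
  have h3 := J.A_alt r X
  have h4 := J.g_φ_φ X (φ r)
  have h5 := J.g_φ_left r h
  have h6 := J.symm (φ r) h
  have h7 := J.g_φ_left r X
  have h8 := J.symm (φ r) X
  rw [J.η_φ] at h4
  rw [map_add, map_add]
  simp only [smul_zero] at h1
  linarith

theorem η_eq_zero_of_h (J : IsParacontactJet g φ ξ η N A) {X h : V}
    (hh : ∀ z, g h z = (g z (N ξ X) - A (φ X) z - A X (φ z)) / 2) : η h = 0 := by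
  rw [← J.g_ξ, hh, J.N_ξ_left, J.A_ξ, J.φ_ξ]
  simp

variable {e f : ι → V}

theorem sum_A_mul_A (J : IsParacontactJet g φ ξ η N A) (F : IsDualFrame g e f) {X h : V}
    (hX : η X = 0) (hh : ∀ z, g h z = (g z (N ξ X) - A (φ X) z - A X (φ z)) / 2) :
    ∑ a, A (e a) X * A (f a) X = - g X X - 2 * g h X - g h h := by
  simp only [J.A_eq_of_h hh]
  have := F.sum_inner_mul_inner (φ (X + h)) (φ (X + h))
  simp only [J.symm (φ (X + h))] at this
  rw [this, J.g_φ_φ]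
  have h1 := J.symm h X
  simp only [map_add, add_apply, J.η_eq_zero_of_h hh, hX]
  linarith

/-- The first order part of the Bochner type formula: contractions of `∇φ` and `∇η` expressed
through `|P(X)|²` and `|h(X)|²`. Here `P(u, ·; X) = g(N u X + g(u, X) ξ, ·)`, because `η(X) = 0`. -/
theorem sum_N_sub_sum_A (J : IsParacontactJet g φ ξ η N A) (F : IsDualFrame g e f) {X h : V}
    (hX : η X = 0) (hXX : g X X = 1)
    (hh : ∀ z, g h z = (g z (N ξ X) - A (φ X) z - A X (φ z)) / 2) :
    ∑ a, (g (N (e a) X) (N (f a) X) - A (e a) X * A (f a) X)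
      = ∑ a, g (N (e a) X + g (e a) X • ξ) (N (f a) X + g (f a) X • ξ) + 2 + g h h := by
  rw [Finset.sum_sub_distrib, J.sum_A_mul_A F hX hh]
  have hξ : ∀ u, g ξ (N u X) = - A u (φ X) := fun u => by rw [J.skew, J.g_N_ξ]
  have e1 : ∀ a, g (N (e a) X + g (e a) X • ξ) (N (f a) X + g (f a) X • ξ)
      = g (N (e a) X) (N (f a) X) + (g (f a) X * (- A (e a) (φ X)) +
        g (e a) X * (- A (f a) (φ X)) + g X (e a) * g X (f a)) := fun a => by
    have h1 : g (N (e a) X) ξ = - A (e a) (φ X) := by rw [J.symm, hξ]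
    simp only [map_add, map_smul, add_apply, smul_apply,
      smul_eq_mul, hξ, h1, J.g_ξ, J.η_ξ, J.symm X]
    ring
  have e2 := F.sum_mul_left (- A.flip (φ X)).toLinearMap X
  have e3 := F.sum_mul_right (- A.flip (φ X)).toLinearMap X
  simp only [ContinuousLinearMap.coe_coe, neg_apply,
    ContinuousLinearMap.flip_apply] at e2 e3
  simp only [e1, Finset.sum_add_distrib, e2, e3, F.sum_inner_mul_inner]
  have e4 : A X (φ X) = g X X - g h X := by
    have h1 := J.A_alt X (φ X)
    have h2 := J.A_eq_of_h hh (φ X)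
    rw [J.φ_sq, hX, zero_smul, sub_zero] at h1
    rw [J.g_φ_φ, hX, map_add, J.symm X h] at h2
    linarith
  linarith

/-- The divergence of `φ` is `2n η`. -/
theorem sum_g_N (J : IsParacontactJet g φ ξ η N A) (F : IsDualFrame g e f) (i : V) :
    ∑ a, g (f a) (N (e a) i) = (Fintype.card ι - 1) * η i := by
  have hdiv : ∀ i, ∑ a, g (f a) (N (e a) (φ i)) = - (∑ a, A (e a) (f a)) * η i := fun i => by
    -- `φ^{ab} (∇_i φ)_{ab} = 0`, the derivative of the trace of `φ²`
    have h1 : ∑ a, g (e a) (N i (φ (f a))) = 0 := by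
      have h2 : ∀ a, g (e a) (N i (φ (f a))) + g (f a) (N i (φ (e a)))
          = - (g (f a) ξ * A i (e a)) - g (e a) ξ * A i (f a) := fun a => by
        have h3 := J.deriv_φ_sq i (e a) (f a)
        have h4 := J.skew i (φ (e a)) (f a)
        rw [J.g_ξ, J.g_ξ]
        linarith
      have h5 := F.sum_mul_left (A i).toLinearMap ξ
      have h6 := F.sum_mul_right (A i).toLinearMap ξ
      have h7 := F.sum_swap (LinearMap.mk₂ ℝ (fun x y => g x (N i (φ y)))
        (by simp) (by simp) (by simp) (by simp))
      simp only [ContinuousLinearMap.coe_coe, J.A_ξ, LinearMap.mk₂_apply] at h5 h6 h7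
      have h8 := Finset.sum_congr rfl fun a (_ : a ∈ Finset.univ) => h2 a
      simp only [Finset.sum_add_distrib, Finset.sum_sub_distrib, Finset.sum_neg_distrib, h5, h6]
        at h8
      linarith
    have h2 : ∑ a, g (φ (f a)) (N (e a) i) = 0 := by
      have h3 := F.sum_skew (LinearMap.mk₂ ℝ (fun x y => g y (N x i))
        (by simp) (by simp) (by simp) (by simp)) J.g_φ_left
      simp only [LinearMap.mk₂_apply] at h3
      have h4 : ∀ a, g (φ (f a)) (N (e a) i) - g (e a) (N (φ (f a)) i)
          = - g (e a) (N i (φ (f a))) := fun a => by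
        have h5 := J.cyclic (e a) (φ (f a)) i
        have h6 := J.skew (φ (f a)) (e a) i
        linarith
      have h8 := Finset.sum_congr rfl fun a (_ : a ∈ Finset.univ) => h4 a
      simp only [Finset.sum_sub_distrib, Finset.sum_neg_distrib, h1] at h8
      linarith
    have h3 := Finset.sum_congr rfl fun a (_ : a ∈ Finset.univ) => J.deriv_φ_sq (e a) (f a) i
    have h4 := F.sum_mul_left (A.flip i).toLinearMap ξ
    simp only [ContinuousLinearMap.coe_coe, ContinuousLinearMap.flip_apply, J.A_ξ_left, J.g_ξ] at h4
    simp only [Finset.sum_sub_distrib, Finset.sum_neg_distrib, h2, h4, ← Finset.sum_mul] at h3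
    linarith
  have h0 : ∑ a, A (e a) (f a) = 0 := by
    have := hdiv ξ
    simpa [J.φ_ξ, J.η_ξ] using this
  have hξ : ∑ a, g (f a) (N (e a) ξ) = Fintype.card ι - 1 := by
    simp only [J.g_N_ξ]
    have h1 := F.sum_skew (LinearMap.mk₂ ℝ (fun x y => A x y)
        (by simp) (by simp) (by simp) (by simp)) J.g_φ_left
    simp only [LinearMap.mk₂_apply] at h1
    have h2 : ∀ a, A (e a) (φ (f a)) - A (φ (f a)) (e a)
        = 2 * (g (f a) (e a) - g (f a) ξ * η (e a)) := fun a => by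
      rw [J.A_alt, J.φ_sq, map_sub, map_smul, J.g_ξ, J.g_ξ, J.symm, smul_eq_mul]
    have h3 := F.sum_mul_left η.toLinearMap ξ
    have h8 := Finset.sum_congr rfl fun a (_ : a ∈ Finset.univ) => h2 a
    simp only [ContinuousLinearMap.coe_coe, J.η_ξ] at h3
    rw [Finset.sum_sub_distrib, ← Finset.mul_sum, Finset.sum_sub_distrib, h3, F.sum_self] at h8
    linarith
  have h1 := hdiv (φ i)
  simp only [h0, J.φ_sq, map_sub, map_smul, smul_eq_mul, Finset.sum_sub_distrib,
    ← Finset.mul_sum, hξ, neg_zero, zero_mul] at h1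
  linarith

/-- A paracontact jet with `h = 0` for which the Nijenhuis tensor of the product structure vanishes
has `P = 0`. -/
theorem N_eq_of_normal (J : IsParacontactJet g φ ξ η N A)
    (hh : ∀ x z, g z (N ξ x) - A (φ x) z - A x (φ z) = 0)
    (hnij : ∀ v w, N (φ v) w - N (φ w) v + φ (N w v) - φ (N v w) - (2 * g v (φ w)) • ξ = 0)
    (u v : V) : N u v = η v • u - g u v • ξ := by
  have hA : ∀ r x, A r x = g r (φ x) := fun r x => by
    have := J.A_eq_of_h (X := x) (h := 0) (fun z => by rw [hh]; simp) r
    simpa using this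
  obtain ⟨P, hP⟩ : ∃ P : V → V → V → ℝ, ∀ u w v,
      P u w v = g w (N u v) - η v * g u w + η w * g u v := ⟨_, fun _ _ _ => rfl⟩
  have skewP : ∀ u w v, P u w v = - P u v w := fun u w v => by
    rw [hP, hP, J.skew]; ring
  have cycP : ∀ u w v, P u w v + P w v u + P v u w = 0 := fun u w v => by
    have h1 := J.cyclic u w v
    have h2 := J.skew w u v
    have h3 := J.skew v u w
    have h4 := J.skew u w v
    simp only [hP]
    rw [J.symm w u, J.symm v u, J.symm v w]
    linarith
  have hPφ : ∀ u w v, P u w (φ v) = P u (φ w) v := fun u w v => by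
    have h1 := J.deriv_φ_sq u w v
    rw [hA, hA] at h1
    simp only [hP, J.η_φ]
    linarith
  have hPξ : ∀ u w, P u w ξ = 0 := fun u w => by
    rw [hP, J.g_N_ξ, hA, J.φ_sq, J.η_ξ, map_sub, map_smul, J.g_ξ, smul_eq_mul]
    ring
  have hnijP : ∀ v w z, P (φ v) z w - P (φ w) z v - P w (φ z) v + P v (φ z) w = 0 :=
    fun v w z => by
      have h1 : g z (N (φ v) w - N (φ w) v + φ (N w v) - φ (N v w) - (2 * g v (φ w)) • ξ) = 0 := by
        rw [hnij, map_zero]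
      simp only [map_add, map_sub, map_smul, smul_eq_mul, J.g_ξ] at h1
      have h2 := J.g_φ_left z (N w v)
      have h3 := J.g_φ_left z (N v w)
      have h4 := J.g_φ_left v w
      have h5 := J.g_φ_left v z
      have h6 := J.g_φ_left w z
      have h8 := J.symm (φ w) v
      simp only [hP, J.η_φ]
      linear_combination h1 - h2 + h3 - η w * h5 + η v * h6 + η z * h4 - η z * h8
  have key : ∀ z v w, P z v (φ w) = 0 := fun z v w => by
    have h1 := hnijP v w z
    have h2 := cycP (φ v) z w
    have h3 := cycP (φ w) z v
    have h4 := hPφ w z v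
    have h5 := hPφ v z w
    have h6 := hPφ z v w
    have h7 := skewP z w (φ v)
    have h8 := skewP w (φ v) z
    have h9 := skewP v (φ w) z
    linarith
  refine sub_eq_zero.1 (J.nondegenerate _ fun w => ?_)
  have h1 := key u w (φ v)
  have h2 := hPξ u w
  rw [hP, J.φ_sq] at h1
  rw [hP] at h2
  have h3 := J.symm w u
  have h4 := J.g_ξ w
  rw [J.symm]
  simp only [map_sub, map_smul, smul_eq_mul, J.η_ξ, h4, h3, J.g_ξ] at h1 h2 ⊢
  linear_combination h1 + η v * h2

/-- The contracted Ricci identity for `φ`, when the curvature is the product of `g` with the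
symmetric form `S = g(T ·, ·)`. The vectors `N₂ u v i` stand for `(∇²_{u,v} φ) i`. -/
theorem ricci_sub_of_secondDeriv (J : IsParacontactJet g φ ξ η N A) (F : IsDualFrame g e f)
    {T : V →L[ℝ] V} (hT : ∀ v w, g (T v) w = g (T w) v) {R N₂ : V → V → V → V}
    (hR : ∀ v w z, R v w z = g (T w) z • v - g (T v) z • w + g w z • T v - g v z • T w)
    (hskew : ∀ u v s i, g s (N₂ u v i) = - g i (N₂ u v s))
    (hcyc : ∀ u v s i, g s (N₂ u v i) + g i (N₂ u s v) + g v (N₂ u i s) = 0)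
    (hricci : ∀ u v i, N₂ u v i - N₂ v u i = R u v (φ i) - φ (R u v i))
    (hdiv : ∀ k i, ∑ a, g (f a) (N₂ k (e a) i) = (Fintype.card ι - 1) * A k i)
    {X : V} (hX : η X = 0) (hXX : g X X = 1)
    (hsq : ∀ u v, g X (N₂ u v (φ X)) = g (N u X) (N v X) - A u X * A v X) :
    ∑ a, (g (N (e a) X) (N (f a) X) - A (e a) X * A (f a) X)
      = 2 * (Fintype.card ι - 1) + ∑ a, g (f a) (R (e a) X X)
        - ∑ a, g (f a) (R (e a) (φ X) (φ X)) - 2 * (g (T X) X - g (T (φ X)) (φ X)) := by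
  -- commuting the derivatives in the divergence of `∇_k φ`
  have htr : ∀ k i, ∑ a, g (f a) (N₂ (e a) k i) = (Fintype.card ι - 1) * A k i
      + ∑ a, g (f a) (R (e a) k (φ i)) - (g (T k) (φ i) - g (T (φ k)) i) := fun k i => by
    -- `φ` and `φ T` are traceless, since `φ` is skew while `g` and `S` are symmetric
    have h1 := Finset.sum_congr rfl fun a (_ : a ∈ Finset.univ) =>
      congrArg (g (f a)) (hricci (e a) k i)
    have hLφ := F.sum_skew (LinearMap.mk₂ ℝ (fun x y => g x y)
      (by simp) (by simp) (by simp) (by simp)) J.g_φ_left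
    have hLT := F.sum_skew (LinearMap.mk₂ ℝ (fun x y => g (T x) y)
      (by simp) (by simp) (by simp) (by simp)) J.g_φ_left
    simp only [LinearMap.mk₂_apply, J.symm (φ _)] at hLφ
    simp only [LinearMap.mk₂_apply, hT (φ _)] at hLT
    have hφ : ∑ a, g (f a) (φ (e a)) = 0 := by
      have : ∀ a, g (f a) (φ (e a)) = - g (e a) (φ (f a)) := fun a => by
        rw [J.symm (e a), J.g_φ_left]; ring
      simp only [this, Finset.sum_neg_distrib]
      linarith
    have hφT : ∑ a, g (f a) (φ (T (e a))) = 0 := by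
      have : ∀ a, g (f a) (φ (T (e a))) = - g (T (e a)) (φ (f a)) := fun a => by
        rw [J.symm (T _), J.g_φ_left]; ring
      simp only [this, Finset.sum_neg_distrib]
      linarith
    have h2 := F.sum_inner_mul_inner (T i) (φ k)
    have h3 := F.sum_inner_mul_inner i (φ (T k))
    have h4 : ∀ a, g (f a) (φ (R (e a) k i)) = g (T k) i * g (f a) (φ (e a))
        - g (T i) (e a) * g (φ k) (f a) + g k i * g (f a) (φ (T (e a)))
        - g i (e a) * g (φ (T k)) (f a) := fun a => by
      rw [hR, hT (e a), J.symm (φ k), J.symm (φ (T k)), J.symm i]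
      simp
    have h5 := hdiv k i
    have h6 : ∑ a, g (f a) (φ (R (e a) k i)) = g (T k) (φ i) - g (T (φ k)) i := by
      simp only [h4, Finset.sum_add_distrib, Finset.sum_sub_distrib, ← Finset.mul_sum, hφ, hφT, h2,
        h3]
      rw [hT i, J.symm i, J.g_φ_left]
      ring
    simp only [map_sub, Finset.sum_sub_distrib] at h1
    linarith
  have h1 : ∀ a, g (N (e a) X) (N (f a) X) - A (e a) X * A (f a) X
      = g (f a) (N₂ (e a) X (φ X)) - g (f a) (N₂ (e a) (φ X) X) := fun a => by
    have h2 := hcyc (e a) (f a) X (φ X)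
    have h3 := hskew (e a) X (φ X) (f a)
    have h4 := hsq (e a) (f a)
    linarith
  have h2 : φ (φ X) = X := by rw [J.φ_sq, hX, zero_smul, sub_zero]
  have h3 := J.A_alt X (φ X)
  rw [h2, hXX] at h3
  simp only [h1, Finset.sum_sub_distrib, htr, h2]
  linear_combination (Fintype.card ι - 1 : ℝ) * h3

end IsParacontactJet

end Jet

/-! ### The Levi-Civita connection in coordinates -/

section LeviCivita

-- Trilinear maps need a deeper search for their norm.
set_option maxSynthPendingDepth 5

variable {m : ℕ}

theorem sum_smul_basisVec (x : E m) : ∑ i, x i • basisVec i = x := by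
  have := (EuclideanSpace.basisFun (Fin m) ℝ).sum_repr x
  simpa [basisVec] using this

theorem fderiv_clm_apply_apply {V W F : Type*} [NormedAddCommGroup V] [NormedSpace ℝ V]
    [NormedAddCommGroup W] [NormedSpace ℝ W] [NormedAddCommGroup F] [NormedSpace ℝ F]
    {c : V → W →L[ℝ] F} {w : V → W} {y : V} (hc : DifferentiableAt ℝ c y)
    (hw : DifferentiableAt ℝ w y) (u : V) :
    fderiv ℝ (fun x => c x (w x)) y u = fderiv ℝ c y u (w y) + c y (fderiv ℝ w y u) := by
  rw [fderiv_clm_apply hc hw]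
  simp [add_comm]

theorem fderiv_clm_apply_const {V W F : Type*} [NormedAddCommGroup V] [NormedSpace ℝ V]
    [NormedAddCommGroup W] [NormedSpace ℝ W] [NormedAddCommGroup F] [NormedSpace ℝ F]
    {c : V → W →L[ℝ] F} {y : V} (hc : DifferentiableAt ℝ c y) (u : V) (w : W) :
    fderiv ℝ (fun x => c x w) y u = fderiv ℝ c y u w := by
  rw [fderiv_clm_apply_apply hc (by fun_prop)]
  simp

theorem fderiv_clm_apply_const₂ {V W W' F : Type*} [NormedAddCommGroup V] [NormedSpace ℝ V]
    [NormedAddCommGroup W] [NormedSpace ℝ W] [NormedAddCommGroup W'] [NormedSpace ℝ W']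
    [NormedAddCommGroup F] [NormedSpace ℝ F] {c : V → W →L[ℝ] W' →L[ℝ] F} {y : V}
    (hc : DifferentiableAt ℝ c y) (u : V) (w : W) (w' : W') :
    fderiv ℝ (fun x => c x w w') y u = fderiv ℝ c y u w w' := by
  rw [fderiv_clm_apply_const (by fun_prop), fderiv_clm_apply_const hc]

/-- A smooth pseudo-Riemannian metric on an open subset of `ℝ^m`. -/
structure IsMetricOn (g : E m → E m →L[ℝ] E m →L[ℝ] ℝ) (Ω : Set (E m)) : Prop where
  isOpen : IsOpen Ω
  smooth : ContDiffOn ℝ ∞ g Ω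
  symm : ∀ x ∈ Ω, ∀ v w, g x v w = g x w v
  nondegenerate : ∀ x ∈ Ω, ∀ v, (∀ w, g x v w = 0) → v = 0

/-- The basis obtained from the coordinate vectors by raising the index with `g`. -/
noncomputable def dualVec (g : E m → E m →L[ℝ] E m →L[ℝ] ℝ) (y : E m) (a : Fin m) : E m :=
  ∑ b, inverseMetric g y a b • basisVec b

/-- The Christoffel symbols as a continuous bilinear map. -/
noncomputable def leviCivita (g : E m → E m →L[ℝ] E m →L[ℝ] ℝ) (y : E m) : E m →L[ℝ] E m →L[ℝ] E m :=
  LinearMap.toContinuousLinearMap <|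
    (LinearMap.toContinuousLinearMap : (E m →ₗ[ℝ] E m) ≃ₗ[ℝ] (E m →L[ℝ] E m)).toLinearMap ∘ₗ
    LinearMap.mk₂ ℝ (christoffel g y)
      (fun v v' w => by
        simp only [christoffel, ← Finset.sum_add_distrib, ← add_smul, map_add, add_apply]
        exact Finset.sum_congr rfl fun k _ => congrArg (· • _)
          (Finset.sum_congr rfl fun l _ => by ring))
      (fun c v w => by
        simp only [christoffel, Finset.smul_sum, smul_smul, map_smul, smul_apply, smul_eq_mul,
          Finset.mul_sum]
        exact Finset.sum_congr rfl fun k _ => congrArg (· • _)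
          (Finset.sum_congr rfl fun l _ => by ring))
      (fun v w w' => by
        simp only [christoffel, ← Finset.sum_add_distrib, ← add_smul, map_add, add_apply]
        exact Finset.sum_congr rfl fun k _ => congrArg (· • _)
          (Finset.sum_congr rfl fun l _ => by ring))
      (fun c v w => by
        simp only [christoffel, Finset.smul_sum, smul_smul, map_smul, smul_apply, smul_eq_mul,
          Finset.mul_sum]
        exact Finset.sum_congr rfl fun k _ => congrArg (· • _)
          (Finset.sum_congr rfl fun l _ => by ring))

theorem leviCivita_apply (g : E m → E m →L[ℝ] E m →L[ℝ] ℝ) (y v w : E m) :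
    leviCivita g y v w = christoffel g y v w := rfl

namespace IsMetricOn

variable {g : E m → E m →L[ℝ] E m →L[ℝ] ℝ} {Ω : Set (E m)} {y : E m}

theorem contDiffAt (hg : IsMetricOn g Ω) (hy : y ∈ Ω) : ContDiffAt ℝ ∞ g y :=
  hg.smooth.contDiffAt (hg.isOpen.mem_nhds hy)

theorem differentiableAt (hg : IsMetricOn g Ω) (hy : y ∈ Ω) : DifferentiableAt ℝ g y :=
  (hg.contDiffAt hy).differentiableAt (by simp)

theorem isUnit_gram (hg : IsMetricOn g Ω) (hy : y ∈ Ω) :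
    IsUnit (Matrix.of fun i j => g y (basisVec i) (basisVec j)) := by
  rw [← Matrix.vecMul_injective_iff_isUnit]
  rw [← Matrix.coe_vecMulLinear, injective_iff_map_eq_zero]
  intro x hx
  have h1 : (WithLp.toLp 2 x : E m) = 0 := by
    refine hg.nondegenerate y hy _ fun w => ?_
    rw [← sum_smul_basisVec w, map_sum]
    refine Finset.sum_eq_zero fun j _ => ?_
    have h2 := congrFun hx j
    rw [← sum_smul_basisVec (WithLp.toLp 2 x)]
    simp only [Matrix.vecMulLinear_apply, Matrix.vecMul, dotProduct, Matrix.of_apply,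
      Pi.zero_apply] at h2
    simp only [map_sum, map_smul, sum_apply, smul_apply, smul_eq_mul, h2, mul_zero]
  simpa using congrArg WithLp.ofLp h1

theorem g_dualVec_basisVec (hg : IsMetricOn g Ω) (hy : y ∈ Ω) (a b : Fin m) :
    g y (dualVec g y a) (basisVec b) = if a = b then 1 else 0 := by
  have h := congrFun (congrFun (Matrix.nonsing_inv_mul _
    ((Matrix.isUnit_iff_isUnit_det _).1 (hg.isUnit_gram hy))) a) b
  rw [Matrix.one_apply, Matrix.mul_apply] at h
  rw [← h]
  simp [dualVec, inverseMetric]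

theorem g_dualVec (hg : IsMetricOn g Ω) (hy : y ∈ Ω) (a : Fin m) (x : E m) :
    g y (dualVec g y a) x = x a := by
  conv_lhs => rw [← sum_smul_basisVec x]
  simp [hg.g_dualVec_basisVec hy]

theorem isDualFrame (hg : IsMetricOn g Ω) (hy : y ∈ Ω) :
    IsDualFrame (g y) basisVec (dualVec g y) where
  symm := hg.symm y hy
  sum_smul_left x := by simp only [hg.g_dualVec hy, sum_smul_basisVec]
  sum_smul_right x := by
    refine sub_eq_zero.1 (hg.nondegenerate y hy _ fun w => ?_)
    conv_lhs => rw [← sum_smul_basisVec w]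
    simp only [map_sub, sub_apply, map_sum, sum_apply, map_smul, smul_apply, smul_eq_mul,
      hg.g_dualVec_basisVec hy]
    refine Finset.sum_eq_zero fun b _ => ?_
    simp [hg.symm y hy x]
  sum_self := by simp [hg.g_dualVec_basisVec hy]

theorem sum_inverseMetric (y : E m) (Q : E m →ₗ[ℝ] E m →ₗ[ℝ] ℝ) :
    ∑ i, ∑ j, inverseMetric g y i j * Q (basisVec i) (basisVec j)
      = ∑ i, Q (basisVec i) (dualVec g y i) := by
  simp [dualVec, map_sum]

/-- The Koszul formula for coordinate vector fields. -/
theorem g_leviCivita (hg : IsMetricOn g Ω) (hy : y ∈ Ω) (v w z : E m) :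
    g y (leviCivita g y v w) z
      = (fderiv ℝ g y v w z + fderiv ℝ g y w v z - fderiv ℝ g y z v w) / 2 := by
  have hdual := hg.isDualFrame hy
  have h1 : leviCivita g y v w = ∑ l, ((fderiv ℝ g y v w (basisVec l)
      + fderiv ℝ g y w v (basisVec l) - fderiv ℝ g y (basisVec l) v w) / 2) • dualVec g y l := by
    have hsymm : ∀ k l, inverseMetric g y k l = inverseMetric g y l k := by
      have : (inverseMetric g y).transpose = inverseMetric g y := by
        rw [inverseMetric, Matrix.transpose_nonsing_inv]
        congr 1
        ext i j
        exact hg.symm y hy _ _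
      exact fun k l => congrFun (congrFun this.symm k) l
    simp only [leviCivita_apply, christoffel, dualVec, Finset.smul_sum, Finset.sum_smul, smul_smul]
    rw [Finset.sum_comm]
    exact Finset.sum_congr rfl fun l _ => Finset.sum_congr rfl fun k _ => by
      rw [hsymm k l, mul_comm]
  rw [h1]
  conv_rhs => rw [← sum_smul_basisVec z]
  simp only [map_sum, map_smul, sum_apply, smul_apply, smul_eq_mul, hg.g_dualVec hy,
    Finset.sum_div, ← Finset.sum_add_distrib, ← Finset.sum_sub_distrib]
  exact Finset.sum_congr rfl fun l _ => by ring

theorem fderiv_symm (hg : IsMetricOn g Ω) (hy : y ∈ Ω) (u v w : E m) :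
    fderiv ℝ g y u v w = fderiv ℝ g y u w v := by
  have hd := hg.differentiableAt hy
  have h : (fun x => g x v w) =ᶠ[nhds y] fun x => g x w v := by
    filter_upwards [hg.isOpen.mem_nhds hy] with x hx using hg.symm x hx v w
  have h2 := congrArg (fun L : E m →L[ℝ] ℝ => L u) h.fderiv_eq
  rwa [fderiv_clm_apply_const₂ hd, fderiv_clm_apply_const₂ hd] at h2

/-- The Levi-Civita connection is metric. -/
theorem fderiv_eq (hg : IsMetricOn g Ω) (hy : y ∈ Ω) (u v w : E m) :
    fderiv ℝ g y u v w = g y (leviCivita g y u v) w + g y v (leviCivita g y u w) := by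
  rw [hg.symm y hy v, hg.g_leviCivita hy, hg.g_leviCivita hy, hg.fderiv_symm hy u w v,
    hg.fderiv_symm hy v u w, hg.fderiv_symm hy w u v]
  ring

theorem leviCivita_comm (hg : IsMetricOn g Ω) (hy : y ∈ Ω) (v w : E m) :
    leviCivita g y v w = leviCivita g y w v := by
  refine sub_eq_zero.1 (hg.nondegenerate y hy _ fun z => ?_)
  rw [map_sub, sub_apply, hg.g_leviCivita hy, hg.g_leviCivita hy, hg.fderiv_symm hy z]
  ring

theorem exists_equiv (hg : IsMetricOn g Ω) (hy : y ∈ Ω) :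
    ∃ e : E m ≃L[ℝ] (E m →L[ℝ] ℝ), (e : E m →L[ℝ] (E m →L[ℝ] ℝ)) = g y := by
  have hinj : Function.Injective (g y).toLinearMap := by
    rw [injective_iff_map_eq_zero]
    exact fun v hv => hg.nondegenerate y hy v fun w => by
      simpa using congrArg (fun L : E m →L[ℝ] ℝ => L w) hv
  have hfin : Module.finrank ℝ (E m) = Module.finrank ℝ (E m →L[ℝ] ℝ) := by
    rw [← (LinearMap.toContinuousLinearMap : (E m →ₗ[ℝ] ℝ) ≃ₗ[ℝ] (E m →L[ℝ] ℝ)).finrank_eq]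
    exact (Subspace.dual_finrank_eq).symm
  refine ⟨(LinearMap.linearEquivOfInjective (g y).toLinearMap hinj hfin).toContinuousLinearEquiv,
    ?_⟩
  ext v w
  rfl

/-- Raising the index of a smooth 1-form gives a smooth vector field. -/
theorem contDiffAt_of_flat (hg : IsMetricOn g Ω) (hy : y ∈ Ω) {X : E m → E m}
    {θ : E m → E m →L[ℝ] ℝ} (hθ : ContDiffAt ℝ ∞ θ y) (h : ∀ x ∈ Ω, ∀ z, g x (X x) z = θ x z) :
    ContDiffAt ℝ ∞ X y := by
  have h1 : ContDiffAt ℝ ∞ (fun x => (g x).inverse (θ x)) y := by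
    obtain ⟨e, he⟩ := hg.exists_equiv hy
    have h2 : ContDiffAt ℝ ∞ ContinuousLinearMap.inverse (g y) := he ▸ contDiffAt_map_inverse e
    exact (h2.comp y (hg.contDiffAt hy)).clm_apply hθ
  refine h1.congr_of_eventuallyEq ?_
  filter_upwards [hg.isOpen.mem_nhds hy] with x hx
  obtain ⟨e, he⟩ := hg.exists_equiv hx
  have h2 : θ x = e (X x) := by
    ext z
    rw [← h x hx z, ← he]
    rfl
  rw [← he, ContinuousLinearMap.inverse_equiv, h2]
  simp

theorem contDiffAt_leviCivita (hg : IsMetricOn g Ω) (hy : y ∈ Ω) :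
    ContDiffAt ℝ ∞ (leviCivita g) y := by
  have key : ∀ x ∈ Ω, ∀ v w, ContDiffAt ℝ ∞ (fun x => leviCivita g x v w) x := by
    intro x hx v w
    have hD : ContDiffAt ℝ ∞ (fderiv ℝ g) x := (hg.contDiffAt hx).fderiv_right (by simp)
    refine hg.contDiffAt_of_flat hx (θ := fun x => (2⁻¹ : ℝ) • (fderiv ℝ g x v w
      + fderiv ℝ g x w v - ((fderiv ℝ g x).flip v).flip w)) ?_ fun x hx z => ?_
    · have h3 : ContDiffAt ℝ ∞ (fun x => ((fderiv ℝ g x).flip v).flip w) x := by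
        have h4 := ((ContinuousLinearMap.flipₗᵢ ℝ (E m) (E m) (E m →L[ℝ] ℝ)
          ).toContinuousLinearEquiv.contDiff.contDiffAt (n := ∞)).comp x hD
        have h5 := h4.clm_apply (contDiffAt_const (c := v))
        have h6 := ((ContinuousLinearMap.flipₗᵢ ℝ (E m) (E m) ℝ
          ).toContinuousLinearEquiv.contDiff.contDiffAt (n := ∞)).comp x h5
        exact h6.clm_apply (contDiffAt_const (c := w))
      exact (((hD.clm_apply contDiffAt_const).clm_apply contDiffAt_const).add
        ((hD.clm_apply contDiffAt_const).clm_apply contDiffAt_const) |>.sub h3).const_smul _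
    · rw [hg.g_leviCivita hx]
      simp
      ring
  have h1 : ContDiffOn ℝ ∞ (leviCivita g) Ω := by
    rw [contDiffOn_clm_apply]
    intro v
    rw [contDiffOn_clm_apply]
    exact fun w x hx => (key x hx v w).contDiffWithinAt
  exact h1.contDiffAt (hg.isOpen.mem_nhds hy)

theorem differentiableAt_leviCivita (hg : IsMetricOn g Ω) (hy : y ∈ Ω) :
    DifferentiableAt ℝ (leviCivita g) y :=
  (hg.contDiffAt_leviCivita hy).differentiableAt (by simp)

theorem curvature_eq (hg : IsMetricOn g Ω) (hy : y ∈ Ω) (v w z : E m) :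
    curvature g y v w z
      = fderiv ℝ (leviCivita g) y v w z + leviCivita g y v (leviCivita g y w z)
        - (fderiv ℝ (leviCivita g) y w v z + leviCivita g y w (leviCivita g y v z)) := by
  have hd := hg.differentiableAt_leviCivita hy
  have h : ∀ v w, covDeriv g y v (fun x => covDeriv g x w fun _ => z)
      = fderiv ℝ (leviCivita g) y v w z + leviCivita g y v (leviCivita g y w z) := fun v w => by
    have h1 : (fun x => covDeriv g x w fun _ => z) = fun x => leviCivita g x w z := by
      ext1 x
      simp [covDeriv, leviCivita_apply]
    rw [h1, covDeriv, fderiv_clm_apply_const (by fun_prop), fderiv_clm_apply_const hd,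
      leviCivita_apply g y v]
  rw [curvature, h, h]

end IsMetricOn

end LeviCivita

/-! ### Conformally flat metrics -/

section Conformal

set_option maxSynthPendingDepth 5

variable {m : ℕ}

namespace IsMetricOn

variable {g : E m → E m →L[ℝ] E m →L[ℝ] ℝ} {Ω : Set (E m)} {y : E m} {u : E m → ℝ}

theorem smul (hg : IsMetricOn g Ω) (hu : ContDiffOn ℝ ∞ u Ω) (hpos : ∀ x ∈ Ω, 0 < u x) :
    IsMetricOn (fun x => u x • g x) Ω where
  isOpen := hg.isOpen
  smooth := hu.smul hg.smooth
  symm x hx v w := by simp [hg.symm x hx v w]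
  nondegenerate x hx v hv := hg.nondegenerate x hx v fun w => by
    simpa [(hpos x hx).ne'] using hv w

/-- If `u g` is flat, then the curvature of `g` is the product of `g` with the symmetric form
`S = g(T ·, ·)`, namely `S = ∇α - α ⊗ α + ½ |α|² g` for `α = ½ d(log u)`. -/
theorem exists_curvature_eq_of_conformallyFlat (hg : IsMetricOn g Ω) (hy : y ∈ Ω)
    (hu : ContDiffOn ℝ ∞ u Ω) (hpos : ∀ x ∈ Ω, 0 < u x)
    (hflat : ∀ v w z, curvature (fun x => u x • g x) y v w z = 0) :
    ∃ T : E m →L[ℝ] E m, (∀ v w, g y (T v) w = g y (T w) v) ∧ ∀ v w z,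
      curvature g y v w z = g y (T w) z • v - g y (T v) z • w + g y w z • T v - g y v z • T w := by
  have hg' := hg.smul hu hpos
  obtain ⟨α, hα⟩ : ∃ α : E m → E m →L[ℝ] ℝ, α = fderiv ℝ fun x => 2⁻¹ * Real.log (u x) := ⟨_, rfl⟩
  obtain ⟨Y, hY⟩ : ∃ Y : E m → E m, Y = fun x => ∑ a, α x (basisVec a) • dualVec g x a := ⟨_, rfl⟩
  have hlog : ∀ x ∈ Ω, ContDiffAt ℝ ∞ (fun x => 2⁻¹ * Real.log (u x)) x := fun x hx =>
    contDiffAt_const.mul ((hu.contDiffAt (hg.isOpen.mem_nhds hx)).log (hpos x hx).ne')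
  have hαs : ∀ x ∈ Ω, ContDiffAt ℝ ∞ α x := fun x hx => by
    rw [hα]
    exact (hlog x hx).fderiv_right (by simp)
  have hgY : ∀ x ∈ Ω, ∀ z, g x (Y x) z = α x z := fun x hx z => by
    rw [hY]
    conv_rhs => rw [← sum_smul_basisVec z]
    simp only [map_sum, sum_apply, map_smul, smul_apply, hg.g_dualVec hx, smul_eq_mul]
    exact Finset.sum_congr rfl fun a _ => mul_comm _ _
  have hYs : ∀ x ∈ Ω, ContDiffAt ℝ ∞ Y x := fun x hx => hg.contDiffAt_of_flat hx (hαs x hx) hgY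
  have hud : ∀ x ∈ Ω, DifferentiableAt ℝ u x := fun x hx =>
    (hu.contDiffAt (hg.isOpen.mem_nhds hx)).differentiableAt (by simp)
  have hdu : ∀ x ∈ Ω, ∀ v, fderiv ℝ u x v = 2 * u x * α x v := fun x hx v => by
    have h1 := ((hud x hx).hasFDerivAt.log (hpos x hx).ne').const_mul 2⁻¹
    rw [hα, h1.fderiv]
    have := (hpos x hx).ne'
    simp
    field_simp
  have hαsymm : ∀ v w, fderiv ℝ α y v w = fderiv ℝ α y w v := by
    rw [hα]
    exact ((hlog y hy).isSymmSndFDerivAt (by simpa using ENat.LEInfty.out)).eq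
  -- The Christoffel symbols of the flat metric; `Y` is the gradient of `½ log u`.
  have hΓ : ∀ x ∈ Ω, ∀ v w, leviCivita (fun x => u x • g x) x v w
      = leviCivita g x v w + α x v • w + α x w • v - g x v w • Y x := fun x hx v w => by
    have hgd := hg.differentiableAt hx
    have hD : ∀ v w z, fderiv ℝ (fun x => u x • g x) x v w z
        = u x * fderiv ℝ g x v w z + 2 * u x * α x v * g x w z := fun v w z => by
      rw [fderiv_fun_smul (hud x hx) hgd]
      simp [hdu x hx]
    refine sub_eq_zero.1 (hg'.nondegenerate x hx _ fun z => ?_)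
    rw [map_sub, sub_apply, hg'.g_leviCivita hx, hD, hD, hD]
    simp only [map_sub, map_add, map_smul, sub_apply, add_apply, smul_apply, smul_eq_mul,
      hg.g_leviCivita hx, hgY x hx]
    rw [hg.symm x hx w z, hg.symm x hx v z]
    ring
  have hgd := hg.differentiableAt hy
  have hαd := (hαs y hy).differentiableAt (by simp)
  have hYd := (hYs y hy).differentiableAt (by simp)
  have hΓd := hg.differentiableAt_leviCivita hy
  have hDΓ : ∀ v w z, fderiv ℝ (leviCivita (fun x => u x • g x)) y v w z
      = fderiv ℝ (leviCivita g) y v w z + fderiv ℝ α y v w • z + fderiv ℝ α y v z • w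
        - (fderiv ℝ g y v w z • Y y + g y w z • fderiv ℝ Y y v) := fun v w z => by
    rw [← fderiv_clm_apply_const₂ (hg'.differentiableAt_leviCivita hy)]
    have h1 : (fun x => leviCivita (fun x => u x • g x) x w z) =ᶠ[nhds y]
        fun x => leviCivita g x w z + α x w • z + α x z • w - g x w z • Y x := by
      filter_upwards [hg.isOpen.mem_nhds hy] with x hx using hΓ x hx w z
    rw [h1.fderiv_eq, fderiv_fun_sub (by fun_prop) (by fun_prop),
      fderiv_fun_add (by fun_prop) (by fun_prop), fderiv_fun_add (by fun_prop) (by fun_prop),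
      fderiv_fun_smul (by fun_prop) (by fun_prop), fderiv_fun_smul (by fun_prop) (by fun_prop),
      fderiv_fun_smul (by fun_prop) (by fun_prop)]
    simp [fderiv_clm_apply_const₂ hΓd, fderiv_clm_apply_const₂ hgd, fderiv_clm_apply_const hαd]
    abel
  -- the Hessian of `½ log u`
  have hH : ∀ v w, g y (fderiv ℝ Y y v + leviCivita g y v (Y y)) w
      = fderiv ℝ α y v w - α y (leviCivita g y v w) := fun v w => by
    have h1 : (fun x => g x (Y x) w) =ᶠ[nhds y] fun x => α x w := by
      filter_upwards [hg.isOpen.mem_nhds hy] with x hx using hgY x hx w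
    have h2 := congrArg (fun L : E m →L[ℝ] ℝ => L v) h1.fderiv_eq
    rw [fderiv_clm_apply_const hαd, fderiv_clm_apply_const (by fun_prop),
      fderiv_clm_apply_apply hgd hYd] at h2
    have h3 := hg.fderiv_eq hy v (Y y) w
    rw [hgY y hy] at h3
    simp only [add_apply, map_add] at h2 ⊢
    linarith
  obtain ⟨K, hK⟩ : ∃ K : E m →L[ℝ] E m, ∀ v, K v = fderiv ℝ Y y v + leviCivita g y v (Y y) :=
    ⟨fderiv ℝ Y y + (leviCivita g y).flip (Y y), fun v => by simp⟩
  obtain ⟨T, hT⟩ : ∃ T : E m →L[ℝ] E m, ∀ v,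
      T v = K v - α y v • Y y + (2⁻¹ * α y (Y y)) • v :=
    ⟨K - (α y).smulRight (Y y) + (2⁻¹ * α y (Y y)) • ContinuousLinearMap.id ℝ _, fun v => by simp⟩
  have hgT : ∀ v w, g y (T v) w = fderiv ℝ α y v w - α y (leviCivita g y v w) - α y v * α y w
      + 2⁻¹ * α y (Y y) * g y v w := fun v w => by
    rw [hT, hK]
    simp only [map_sub, map_add, map_smul, sub_apply, add_apply, smul_apply, smul_eq_mul,
      hgY y hy, ← hH]
  refine ⟨T, fun v w => ?_, fun v w z => ?_⟩
  · rw [hgT, hgT, hαsymm v w, hg.leviCivita_comm hy v w, hg.symm y hy v w]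
    ring
  · have h0 := hflat v w z
    rw [hg'.curvature_eq hy, hDΓ, hDΓ] at h0
    simp only [hΓ y hy, hg.fderiv_eq hy, map_sub, map_add, map_smul, smul_eq_mul,
      hαsymm w v, hg.leviCivita_comm hy w v, hg.symm y hy w v] at h0
    have hKv : fderiv ℝ Y y v = K v - leviCivita g y v (Y y) := by rw [hK]; abel
    have hKw : fderiv ℝ Y y w = K w - leviCivita g y w (Y y) := by rw [hK]; abel
    rw [hg.curvature_eq hy, hgT, hgT, hT v, hT w]
    have h1 := hg.symm y hy v (Y y)
    have h2 := hg.symm y hy w (Y y)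
    rw [hgY y hy] at h1 h2
    rw [hKv, hKw, h1, h2] at h0
    rw [← sub_eq_zero, ← h0]
    module

end IsMetricOn

end Conformal

/-! ### Covariant derivatives of the structure tensors -/

section Structure

set_option maxSynthPendingDepth 5

variable {m : ℕ}

/-- The covariant derivative `∇φ` as a bilinear map. -/
noncomputable def nablaEnd (g : E m → E m →L[ℝ] E m →L[ℝ] ℝ) (φ : E m → E m →L[ℝ] E m) (x : E m) :
    E m →L[ℝ] E m →L[ℝ] E m :=
  fderiv ℝ φ x + ((ContinuousLinearMap.compL ℝ (E m) (E m) (E m)).flip (φ x)).comp (leviCivita g x)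
    - ((ContinuousLinearMap.compL ℝ (E m) (E m) (E m)) (φ x)).comp (leviCivita g x)

/-- The covariant derivative `∇η` as a bilinear form. -/
noncomputable def nablaForm (g : E m → E m →L[ℝ] E m →L[ℝ] ℝ) (η : E m → E m →L[ℝ] ℝ) (x : E m) :
    E m →L[ℝ] E m →L[ℝ] ℝ :=
  fderiv ℝ η x - ((ContinuousLinearMap.compL ℝ (E m) (E m) ℝ) (η x)).comp (leviCivita g x)

/-- The second covariant derivative `(∇²_{u, v} φ) i`, with `u` the direction of the outer
derivative. -/
noncomputable def nablaSqEnd (g : E m → E m →L[ℝ] E m →L[ℝ] ℝ) (φ : E m → E m →L[ℝ] E m)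
    (y u v i : E m) : E m :=
  fderiv ℝ (nablaEnd g φ) y u v i + leviCivita g y u (nablaEnd g φ y v i)
    - nablaEnd g φ y (leviCivita g y u v) i - nablaEnd g φ y v (leviCivita g y u i)

theorem nablaEnd_apply (g : E m → E m →L[ℝ] E m →L[ℝ] ℝ) (φ : E m → E m →L[ℝ] E m)
    (x v i : E m) : nablaEnd g φ x v i
      = fderiv ℝ φ x v i + leviCivita g x v (φ x i) - φ x (leviCivita g x v i) := rfl

theorem nablaForm_apply (g : E m → E m →L[ℝ] E m →L[ℝ] ℝ) (η : E m → E m →L[ℝ] ℝ)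
    (x v i : E m) : nablaForm g η x v i = fderiv ℝ η x v i - η x (leviCivita g x v i) := rfl

theorem covDeriv_const (g : E m → E m →L[ℝ] E m →L[ℝ] ℝ) (y u s : E m) :
    covDeriv g y u (fun _ => s) = leviCivita g y u s := by
  simp [covDeriv, leviCivita_apply]

theorem fderiv_eq_of_eqOn {F : Type*} [NormedAddCommGroup F] [NormedSpace ℝ F] {Ω : Set (E m)}
    (hΩ : IsOpen Ω) {y : E m} (hy : y ∈ Ω) {a b : E m → F} (h : ∀ x ∈ Ω, a x = b x) (u : E m) :
    fderiv ℝ a y u = fderiv ℝ b y u := by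
  have : a =ᶠ[nhds y] b := by
    filter_upwards [hΩ.mem_nhds hy] with x hx using h x hx
  rw [this.fderiv_eq]

/-- Metric compatibility for arbitrary vector fields. -/
theorem IsMetricOn.fderiv_inner {g : E m → E m →L[ℝ] E m →L[ℝ] ℝ} {Ω : Set (E m)} {y : E m}
    (hg : IsMetricOn g Ω) (hy : y ∈ Ω) {a b : E m → E m} (ha : DifferentiableAt ℝ a y)
    (hb : DifferentiableAt ℝ b y) (u : E m) :
    fderiv ℝ (fun x => g x (a x) (b x)) y u
      = g y (covDeriv g y u a) (b y) + g y (a y) (covDeriv g y u b) := by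
  have hd := hg.differentiableAt hy
  rw [fderiv_clm_apply_apply (by fun_prop) hb, fderiv_clm_apply_apply hd ha, covDeriv, covDeriv,
    add_apply, hg.fderiv_eq hy]
  simp only [map_add, add_apply, leviCivita_apply]
  ring

/-- A smooth paracontact metric structure on an open subset of `ℝ^m`. -/
structure IsParacontactOn (g : E m → E m →L[ℝ] E m →L[ℝ] ℝ) (φ : E m → E m →L[ℝ] E m)
    (ξ : E m → E m) (η : E m → E m →L[ℝ] ℝ) (Ω : Set (E m)) : Prop extends IsMetricOn g Ω where
  smooth_φ : ContDiffOn ℝ ∞ φ Ω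
  smooth_ξ : ContDiffOn ℝ ∞ ξ Ω
  smooth_η : ContDiffOn ℝ ∞ η Ω
  φ_ξ : ∀ x ∈ Ω, φ x (ξ x) = 0
  η_φ : ∀ x ∈ Ω, ∀ v, η x (φ x v) = 0
  η_ξ : ∀ x ∈ Ω, η x (ξ x) = 1
  φ_sq : ∀ x ∈ Ω, ∀ v, φ x (φ x v) = v - η x v • ξ x
  g_φ_φ : ∀ x ∈ Ω, ∀ v w, g x (φ x v) (φ x w) = - g x v w + η x v * η x w
  paracontact : ∀ x ∈ Ω, ∀ v w, g x v (φ x w) = dOneForm η x v w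

namespace IsParacontactOn

variable {g : E m → E m →L[ℝ] E m →L[ℝ] ℝ} {φ : E m → E m →L[ℝ] E m} {ξ : E m → E m}
  {η : E m → E m →L[ℝ] ℝ} {Ω : Set (E m)} {y : E m}

theorem contDiffAt_φ (h : IsParacontactOn g φ ξ η Ω) (hy : y ∈ Ω) : ContDiffAt ℝ ∞ φ y :=
  h.smooth_φ.contDiffAt (h.isOpen.mem_nhds hy)

theorem contDiffAt_η (h : IsParacontactOn g φ ξ η Ω) (hy : y ∈ Ω) : ContDiffAt ℝ ∞ η y :=
  h.smooth_η.contDiffAt (h.isOpen.mem_nhds hy)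

theorem differentiableAt_φ (h : IsParacontactOn g φ ξ η Ω) (hy : y ∈ Ω) :
    DifferentiableAt ℝ φ y := (h.contDiffAt_φ hy).differentiableAt (by simp)

theorem differentiableAt_η (h : IsParacontactOn g φ ξ η Ω) (hy : y ∈ Ω) :
    DifferentiableAt ℝ η y := (h.contDiffAt_η hy).differentiableAt (by simp)

theorem differentiableAt_ξ (h : IsParacontactOn g φ ξ η Ω) (hy : y ∈ Ω) :
    DifferentiableAt ℝ ξ y :=
  (h.smooth_ξ.contDiffAt (h.isOpen.mem_nhds hy)).differentiableAt (by simp)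

theorem differentiableAt_fderiv_φ (h : IsParacontactOn g φ ξ η Ω) (hy : y ∈ Ω) :
    DifferentiableAt ℝ (fderiv ℝ φ) y :=
  ((h.contDiffAt_φ hy).fderiv_right (m := ∞) (by simp)).differentiableAt (by simp)

theorem differentiableAt_fderiv_η (h : IsParacontactOn g φ ξ η Ω) (hy : y ∈ Ω) :
    DifferentiableAt ℝ (fderiv ℝ η) y :=
  ((h.contDiffAt_η hy).fderiv_right (m := ∞) (by simp)).differentiableAt (by simp)

theorem differentiableAt_nablaEnd (h : IsParacontactOn g φ ξ η Ω) (hy : y ∈ Ω) :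
    DifferentiableAt ℝ (nablaEnd g φ) y := by
  have h1 := h.differentiableAt_fderiv_φ hy
  have h2 := h.differentiableAt_φ hy
  have h3 := h.differentiableAt_leviCivita hy
  unfold nablaEnd
  fun_prop

theorem differentiableAt_nablaForm (h : IsParacontactOn g φ ξ η Ω) (hy : y ∈ Ω) :
    DifferentiableAt ℝ (nablaForm g η) y := by
  have h1 := h.differentiableAt_fderiv_η hy
  have h2 := h.differentiableAt_η hy
  have h3 := h.differentiableAt_leviCivita hy
  unfold nablaForm
  fun_prop

theorem covDeriv_φ (h : IsParacontactOn g φ ξ η Ω) (hy : y ∈ Ω) {a : E m → E m}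
    (ha : DifferentiableAt ℝ a y) (u : E m) :
    covDeriv g y u (fun x => φ x (a x)) = nablaEnd g φ y u (a y) + φ y (covDeriv g y u a) := by
  rw [covDeriv, covDeriv, fderiv_clm_apply_apply (h.differentiableAt_φ hy) ha, nablaEnd_apply,
    map_add, leviCivita_apply, leviCivita_apply]
  abel

theorem covDeriv_nablaEnd (h : IsParacontactOn g φ ξ η Ω) (hy : y ∈ Ω) {a : E m → E m}
    (ha : DifferentiableAt ℝ a y) (u v : E m) :
    covDeriv g y u (fun x => nablaEnd g φ x v (a x)) = nablaSqEnd g φ y u v (a y)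
      + nablaEnd g φ y (leviCivita g y u v) (a y) + nablaEnd g φ y v (covDeriv g y u a) := by
  have hd := h.differentiableAt_nablaEnd hy
  rw [covDeriv, covDeriv, fderiv_clm_apply_apply (by fun_prop) ha, fderiv_clm_apply_const hd,
    nablaSqEnd, map_add, leviCivita_apply g y u (a y), leviCivita_apply g y u (nablaEnd g φ y v _)]
  abel

theorem fderiv_η_apply (h : IsParacontactOn g φ ξ η Ω) (hy : y ∈ Ω) {a : E m → E m}
    (ha : DifferentiableAt ℝ a y) (u : E m) :
    fderiv ℝ (fun x => η x (a x)) y u = nablaForm g η y u (a y) + η y (covDeriv g y u a) := by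
  rw [fderiv_clm_apply_apply (h.differentiableAt_η hy) ha, nablaForm_apply, covDeriv, map_add,
    leviCivita_apply]
  ring

theorem g_ξ (h : IsParacontactOn g φ ξ η Ω) (hy : y ∈ Ω) (x : E m) : g y x (ξ y) = η y x := by
  have := h.g_φ_φ y hy x (ξ y)
  rw [h.φ_ξ y hy, h.η_ξ y hy, map_zero] at this
  linarith

theorem g_φ_left (h : IsParacontactOn g φ ξ η Ω) (hy : y ∈ Ω) (v w : E m) :
    g y (φ y v) w = - g y v (φ y w) := by
  have := h.g_φ_φ y hy v (φ y w)
  rw [h.φ_sq y hy, h.η_φ y hy, map_sub, map_smul, h.g_ξ hy, h.η_φ y hy] at this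
  simpa using this

/-- A paracontact metric structure satisfies the first order relations at each point: these are the
derivatives of the algebraic identities, and `d(dη) = 0`. -/
theorem jet (h : IsParacontactOn g φ ξ η Ω) (hy : y ∈ Ω) :
    IsParacontactJet (g y) (φ y) (ξ y) (η y) (nablaEnd g φ y) (nablaForm g η y) := by
  have hφd := h.differentiableAt_φ hy
  have hηd := h.differentiableAt_η hy
  have hξd := h.differentiableAt_ξ hy
  have hD : ∀ u s i, fderiv ℝ (fun x => g x s (φ x i)) y u
      = g y (leviCivita g y u s) (φ y i)
        + g y s (nablaEnd g φ y u i + φ y (leviCivita g y u i)) := fun u s i => by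
    rw [h.fderiv_inner hy (by fun_prop) (by fun_prop), h.covDeriv_φ hy (by fun_prop),
      covDeriv_const, covDeriv_const]
  have hΦ : ∀ s i, g y s (φ y i) = - g y i (φ y s) := fun s i => by
    rw [h.symm y hy, h.g_φ_left hy]
  refine ⟨h.symm y hy, h.nondegenerate y hy, h.φ_ξ y hy, h.η_φ y hy, h.η_ξ y hy, h.φ_sq y hy,
    h.g_φ_φ y hy, fun v s i => ?_, fun v s i => ?_, fun v s i => ?_, fun v => ?_, fun v s => ?_⟩
  · have h1 := fderiv_eq_of_eqOn h.isOpen hy (a := fun x => g x s (φ x i))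
      (b := fun x => - g x i (φ x s)) (fun x hx => by rw [h.symm x hx, h.g_φ_left hx]) v
    rw [fderiv_fun_neg, neg_apply, hD, hD, map_add, map_add] at h1
    have h2 := hΦ (leviCivita g y v s) i
    have h3 := hΦ (leviCivita g y v i) s
    linarith
  · have hd := h.differentiableAt_fderiv_η hy
    have h1 : ∀ v s i, g y (leviCivita g y v s) (φ y i)
        + g y s (nablaEnd g φ y v i + φ y (leviCivita g y v i))
        = 2⁻¹ * (fderiv ℝ (fderiv ℝ η) y v s i - fderiv ℝ (fderiv ℝ η) y v i s) :=
      fun v s i => by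
        rw [← hD, fderiv_eq_of_eqOn h.isOpen hy
          (b := fun x => 2⁻¹ * (fderiv ℝ η x s i - fderiv ℝ η x i s))
          (fun x hx => by rw [h.paracontact x hx, dOneForm]; ring),
          fderiv_const_mul (by fun_prop), fderiv_fun_sub (by fun_prop) (by fun_prop)]
        simp only [smul_apply, sub_apply, smul_eq_mul, fderiv_clm_apply_const₂ hd]
    have h2 := h1 v s i
    have h3 := h1 s i v
    have h4 := h1 i v s
    have hs := ((h.contDiffAt_η hy).isSymmSndFDerivAt (by simpa using ENat.LEInfty.out)).eq
    rw [hs i v, hs i s, h.leviCivita_comm hy i v, h.leviCivita_comm hy i s, map_add] at h4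
    rw [hs s v, h.leviCivita_comm hy s v, map_add] at h3
    rw [map_add] at h2
    have h5 := hΦ (leviCivita g y v s) i
    have h6 := hΦ (leviCivita g y v i) s
    have h7 := hΦ (leviCivita g y s i) v
    linarith
  · have h1 := fderiv_eq_of_eqOn h.isOpen hy (a := fun x => g x s (φ x (φ x i)))
      (b := fun x => g x s i - η x s * η x i)
      (fun x hx => by rw [h.φ_sq x hx, map_sub, map_smul, h.g_ξ hx, smul_eq_mul]; ring) v
    have hgd := h.differentiableAt hy
    rw [h.fderiv_inner hy (by fun_prop) (by fun_prop), h.covDeriv_φ hy (by fun_prop),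
      h.covDeriv_φ hy (by fun_prop), fderiv_fun_sub (by fun_prop) (by fun_prop),
      fderiv_fun_mul (by fun_prop) (by fun_prop), sub_apply,
      h.fderiv_inner hy (by fun_prop) (by fun_prop)] at h1
    simp only [add_apply, smul_apply, h.fderiv_η_apply hy (differentiableAt_const _),
      covDeriv_const, smul_eq_mul, map_add, h.φ_sq y hy, map_sub, map_smul, h.g_ξ hy] at h1
    rw [h.g_φ_left hy]
    linarith
  · have h1 := fderiv_eq_of_eqOn h.isOpen hy (a := fun x => η x (ξ x)) (b := fun _ => 1)
      h.η_ξ v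
    have h2 := fderiv_eq_of_eqOn h.isOpen hy (a := fun x => g x (ξ x) (ξ x)) (b := fun _ => 1)
      (fun x hx => by rw [h.g_ξ hx, h.η_ξ x hx]) v
    rw [h.fderiv_η_apply hy hξd] at h1
    rw [h.fderiv_inner hy hξd hξd, h.symm y hy (ξ y), h.g_ξ hy] at h2
    simp only [fderiv_fun_const, Pi.zero_apply, zero_apply] at h1 h2
    linarith
  · rw [nablaForm_apply, nablaForm_apply, h.leviCivita_comm hy s v, h.paracontact y hy, dOneForm]
    ring

theorem nablaForm_eq (h : IsParacontactOn g φ ξ η Ω) (hy : y ∈ Ω) (v s : E m) :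
    nablaForm g η y v s = g y (covDeriv g y v ξ) s := by
  have h1 := fderiv_eq_of_eqOn h.isOpen hy (a := fun x => g x (ξ x) s) (b := fun x => η x s)
    (fun x hx => by rw [h.symm x hx, h.g_ξ hx]) v
  have hξd := h.differentiableAt_ξ hy
  rw [h.fderiv_inner hy hξd (by fun_prop), h.fderiv_η_apply hy (by fun_prop), covDeriv_const,
    h.symm y hy (ξ y), h.g_ξ hy] at h1
  linarith

theorem g_hLocal (h : IsParacontactOn g φ ξ η Ω) (hy : y ∈ Ω) (v z : E m) :
    g y (hLocal φ ξ y v) z = (g y z (nablaEnd g φ y (ξ y) v) - nablaForm g η y (φ y v) z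
      - nablaForm g η y v (φ y z)) / 2 := by
  have hφd := h.differentiableAt_φ hy
  have h1 : hLocal φ ξ y v = (1 / 2 : ℝ) • (nablaEnd g φ y (ξ y) v - covDeriv g y (φ y v) ξ
      + φ y (covDeriv g y v ξ)) := by
    rw [hLocal, lieBracket, lieBracket, fderiv_clm_apply_const hφd, nablaEnd_apply, covDeriv,
      covDeriv, ← leviCivita_apply, ← leviCivita_apply, h.leviCivita_comm hy (φ y v),
      h.leviCivita_comm hy v]
    simp only [fderiv_fun_const, Pi.zero_apply, zero_apply, map_sub, map_add, map_zero]
    module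
  rw [h1, h.nablaForm_eq hy, h.nablaForm_eq hy, h.symm y hy z]
  simp only [map_smul, smul_apply, map_add, map_sub, add_apply, sub_apply, smul_eq_mul,
    h.g_φ_left hy]
  ring

theorem covDerivEnd_eq (h : IsParacontactOn g φ ξ η Ω) (hy : y ∈ Ω) (v w : E m) :
    covDerivEnd g φ y v w = nablaEnd g φ y v w := by
  rw [covDerivEnd, h.covDeriv_φ hy (by fun_prop)]
  abel

end IsParacontactOn

end Structure

/-! ### Second covariant derivatives of `φ` -/

section SecondOrder

set_option maxSynthPendingDepth 5

variable {m : ℕ}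

namespace IsParacontactOn

variable {g : E m → E m →L[ℝ] E m →L[ℝ] ℝ} {φ : E m → E m →L[ℝ] E m} {ξ : E m → E m}
  {η : E m → E m →L[ℝ] ℝ} {Ω : Set (E m)} {y : E m}

theorem fderiv_g_nablaEnd (h : IsParacontactOn g φ ξ η Ω) (hy : y ∈ Ω) (u v s i : E m) :
    fderiv ℝ (fun x => g x s (nablaEnd g φ x v i)) y u
      = g y (leviCivita g y u s) (nablaEnd g φ y v i)
        + g y s (nablaSqEnd g φ y u v i + nablaEnd g φ y (leviCivita g y u v) i
          + nablaEnd g φ y v (leviCivita g y u i)) := by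
  have hd := h.differentiableAt_nablaEnd hy
  rw [h.fderiv_inner hy (by fun_prop) (by fun_prop), h.covDeriv_nablaEnd hy (by fun_prop),
    covDeriv_const, covDeriv_const]

theorem g_nablaSqEnd_skew (h : IsParacontactOn g φ ξ η Ω) (hy : y ∈ Ω) (u v s i : E m) :
    g y s (nablaSqEnd g φ y u v i) = - g y i (nablaSqEnd g φ y u v s) := by
  have h1 := fderiv_eq_of_eqOn h.isOpen hy (fun x hx => (h.jet hx).skew v s i) u
  have J := h.jet hy
  rw [fderiv_fun_neg, neg_apply, h.fderiv_g_nablaEnd hy, h.fderiv_g_nablaEnd hy] at h1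
  simp only [map_add] at h1
  have h2 := J.skew v (leviCivita g y u s) i
  have h3 := J.skew v s (leviCivita g y u i)
  have h4 := J.skew (leviCivita g y u v) s i
  linarith

theorem g_nablaSqEnd_cyclic (h : IsParacontactOn g φ ξ η Ω) (hy : y ∈ Ω) (u v s i : E m) :
    g y s (nablaSqEnd g φ y u v i) + g y i (nablaSqEnd g φ y u s v)
      + g y v (nablaSqEnd g φ y u i s) = 0 := by
  have hd := h.differentiableAt_nablaEnd hy
  have hgd := h.differentiableAt hy
  have h1 := fderiv_eq_of_eqOn h.isOpen hy (fun x hx => (h.jet hx).cyclic v s i) u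
  have J := h.jet hy
  rw [fderiv_fun_add (by fun_prop) (by fun_prop), fderiv_fun_add (by fun_prop) (by fun_prop),
    add_apply, add_apply, h.fderiv_g_nablaEnd hy, h.fderiv_g_nablaEnd hy,
    h.fderiv_g_nablaEnd hy] at h1
  simp only [map_add, fderiv_fun_const, Pi.zero_apply, zero_apply] at h1
  have h2 := J.cyclic (leviCivita g y u v) s i
  have h3 := J.cyclic v (leviCivita g y u s) i
  have h4 := J.cyclic v s (leviCivita g y u i)
  linarith

/-- The covariant derivative of `div φ = 2n η`. -/
theorem sum_g_nablaSqEnd (h : IsParacontactOn g φ ξ η Ω) (hy : y ∈ Ω) (k i : E m) :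
    ∑ a, g y (dualVec g y a) (nablaSqEnd g φ y k (basisVec a) i)
      = (Fintype.card (Fin m) - 1) * nablaForm g η y k i := by
  have hd := h.differentiableAt_nablaEnd hy
  have J := h.jet hy
  have F := h.isDualFrame hy
  have h1 := fderiv_eq_of_eqOn h.isOpen hy
    (a := fun x => ∑ a, EuclideanSpace.proj (𝕜 := ℝ) a (nablaEnd g φ x (basisVec a) i))
    (b := fun x => (Fintype.card (Fin m) - 1) * η x i) (fun x hx => by
      rw [← (h.jet hx).sum_g_N (h.isDualFrame hx) i]
      exact Finset.sum_congr rfl fun a _ => by rw [h.g_dualVec hx]; rfl) k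
  have h2 : ∀ a, fderiv ℝ (fun x => EuclideanSpace.proj (𝕜 := ℝ) a
      (nablaEnd g φ x (basisVec a) i)) y k
      = g y (dualVec g y a) (fderiv ℝ (nablaEnd g φ) y k (basisVec a) i) := fun a => by
    rw [fderiv_clm_apply_apply (by fun_prop) (by fun_prop), fderiv_clm_apply_const₂ hd,
      h.g_dualVec hy]
    simp
  have hηd := h.differentiableAt_η hy
  rw [fderiv_fun_sum (fun a _ => by fun_prop), sum_apply, fderiv_const_mul (by fun_prop),
    smul_apply, h.fderiv_η_apply hy (by fun_prop), covDeriv_const] at h1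
  simp only [h2] at h1
  have h3 := F.sum_trace_comm (leviCivita g y k) ((nablaEnd g φ y).flip i)
  have h4 := J.sum_g_N F (leviCivita g y k i)
  simp only [ContinuousLinearMap.flip_apply] at h3
  simp only [nablaSqEnd, map_sub, map_add, Finset.sum_sub_distrib, Finset.sum_add_distrib, h1, h3,
    h4, smul_eq_mul]
  ring

/-- The Ricci identity for `φ`. -/
theorem nablaSqEnd_sub (h : IsParacontactOn g φ ξ η Ω) (hy : y ∈ Ω) (u v i : E m) :
    nablaSqEnd g φ y u v i - nablaSqEnd g φ y v u i
      = curvature g y u v (φ y i) - φ y (curvature g y u v i) := by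
  have hφd := h.differentiableAt_φ hy
  have hφd' := h.differentiableAt_fderiv_φ hy
  have hΓd := h.differentiableAt_leviCivita hy
  have hs := ((h.contDiffAt_φ hy).isSymmSndFDerivAt (by simpa using ENat.LEInfty.out)).eq
  have hD : ∀ u v i, fderiv ℝ (nablaEnd g φ) y u v i = fderiv ℝ (fderiv ℝ φ) y u v i
      + (fderiv ℝ (leviCivita g) y u v (φ y i) + leviCivita g y v (fderiv ℝ φ y u i))
      - (fderiv ℝ φ y u (leviCivita g y v i) + φ y (fderiv ℝ (leviCivita g) y u v i)) :=
    fun u v i => by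
      rw [← fderiv_clm_apply_const₂ (h.differentiableAt_nablaEnd hy)]
      simp only [nablaEnd_apply]
      rw [fderiv_fun_sub (by fun_prop) (by fun_prop), fderiv_fun_add (by fun_prop) (by fun_prop),
        sub_apply, add_apply, fderiv_clm_apply_const₂ hφd',
        fderiv_clm_apply_apply (by fun_prop) (by fun_prop), fderiv_clm_apply_const hΓd,
        fderiv_clm_apply_const hφd, fderiv_clm_apply_apply hφd (by fun_prop),
        fderiv_clm_apply_const₂ hΓd]
  rw [nablaSqEnd, nablaSqEnd, hD, hD, hs u v, h.curvature_eq hy, h.curvature_eq hy,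
    h.leviCivita_comm hy u v]
  simp only [nablaEnd_apply, map_add, map_sub]
  abel

/-- The second covariant derivative of `φ² = id - η ⊗ ξ`, evaluated on a vector of `ker η`. -/
theorem g_nablaSqEnd_φ (h : IsParacontactOn g φ ξ η Ω) (hy : y ∈ Ω) {X : E m} (hX : η y X = 0)
    (u v : E m) : g y X (nablaSqEnd g φ y u v (φ y X))
      = g y (nablaEnd g φ y u X) (nablaEnd g φ y v X)
        - nablaForm g η y u X * nablaForm g η y v X := by
  have hNd := h.differentiableAt_nablaEnd hy
  have hAd := h.differentiableAt_nablaForm hy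
  have hφd := h.differentiableAt_φ hy
  have hηd := h.differentiableAt_η hy
  have hgd := h.differentiableAt hy
  have J := h.jet hy
  have h1 := fderiv_eq_of_eqOn h.isOpen hy (fun x hx => (h.jet hx).deriv_φ_sq v X X) u
  rw [fderiv_fun_sub (by fun_prop) (by fun_prop), fderiv_fun_sub (by fun_prop) (by fun_prop),
    fderiv_fun_neg, fderiv_fun_mul (by fun_prop) (by fun_prop),
    fderiv_fun_mul (by fun_prop) (by fun_prop), sub_apply, sub_apply, neg_apply,
    h.fderiv_inner hy (by fun_prop) (by fun_prop), h.fderiv_inner hy (by fun_prop) (by fun_prop),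
    h.covDeriv_nablaEnd hy (by fun_prop), h.covDeriv_nablaEnd hy (by fun_prop),
    h.covDeriv_φ hy (by fun_prop)] at h1
  simp only [add_apply, smul_apply, h.fderiv_η_apply hy (differentiableAt_const _),
    covDeriv_const, smul_eq_mul, map_add, hX] at h1
  have h2 := J.deriv_φ_sq (leviCivita g y u v) X X
  have h3 := J.deriv_φ_sq v (leviCivita g y u X) X
  have h4 := J.deriv_φ_sq v X (leviCivita g y u X)
  have h5 := h.g_nablaSqEnd_skew hy u v X (φ y X)
  have h6 := J.skew v X (nablaEnd g φ y u X)
  rw [hX] at h2 h3 h4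
  linarith

end IsParacontactOn

end SecondOrder

/-! ### The Ricci curvature in coordinates -/

section RicciFormula

set_option maxSynthPendingDepth 5

variable {m : ℕ}

theorem IsMetricOn.ricciLocal_eq {g : E m → E m →L[ℝ] E m →L[ℝ] ℝ} {Ω : Set (E m)} {y : E m}
    (hg : IsMetricOn g Ω) (hy : y ∈ Ω) (v w : E m) :
    ricciLocal g y v w = ∑ a, g y (dualVec g y a) (curvature g y (basisVec a) v w) := by
  simp only [ricciLocal, hg.g_dualVec hy]

/-- The Ricci tensor of a curvature tensor which is the product of `g` and `S = g(T ·, ·)`. -/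
theorem IsMetricOn.ricciLocal_eq_of_curvature_eq {g : E m → E m →L[ℝ] E m →L[ℝ] ℝ}
    {Ω : Set (E m)} {y : E m} (hg : IsMetricOn g Ω) (hy : y ∈ Ω) {T : E m →L[ℝ] E m}
    (hT : ∀ v w, g y (T v) w = g y (T w) v)
    (hR : ∀ v w z, curvature g y v w z
      = g y (T w) z • v - g y (T v) z • w + g y w z • T v - g y v z • T w) (v w : E m) :
    ricciLocal g y v w = (m - 2) * g y (T v) w
      + (∑ a, g y (dualVec g y a) (T (basisVec a))) * g y v w := by
  have F := hg.isDualFrame hy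
  have h1 := F.sum_inner_mul_inner (T w) v
  have h2 := F.sum_inner_mul_inner w (T v)
  have h3 : ∀ a, g y (dualVec g y a) (curvature g y (basisVec a) v w)
      = g y (T v) w * g y (dualVec g y a) (basisVec a)
        - g y (T w) (basisVec a) * g y v (dualVec g y a)
        + g y v w * g y (dualVec g y a) (T (basisVec a))
        - g y w (basisVec a) * g y (T v) (dualVec g y a) := fun a => by
    rw [hR, hT (basisVec a), hg.symm y hy v (dualVec g y a), hg.symm y hy (T v) (dualVec g y a),
      hg.symm y hy w (basisVec a)]
    simp
  rw [hg.ricciLocal_eq hy]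
  simp only [h3, Finset.sum_add_distrib, Finset.sum_sub_distrib, ← Finset.mul_sum, F.sum_self, h1,
    h2]
  rw [hT w v, hg.symm y hy w, Fintype.card_fin]
  ring

theorem IsMetricOn.scalLocal_eq_of_curvature_eq {g : E m → E m →L[ℝ] E m →L[ℝ] ℝ}
    {Ω : Set (E m)} {y : E m} (hg : IsMetricOn g Ω) (hy : y ∈ Ω) {T : E m →L[ℝ] E m}
    (hT : ∀ v w, g y (T v) w = g y (T w) v)
    (hR : ∀ v w z, curvature g y v w z
      = g y (T w) z • v - g y (T v) z • w + g y w z • T v - g y v z • T w) :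
    scalLocal g y = 2 * (m - 1) * ∑ a, g y (dualVec g y a) (T (basisVec a)) := by
  have F := hg.isDualFrame hy
  obtain ⟨τ, hτ⟩ : ∃ τ, τ = ∑ a, g y (dualVec g y a) (T (basisVec a)) := ⟨_, rfl⟩
  have h1 := IsMetricOn.sum_inverseMetric (g := g) y (LinearMap.mk₂ ℝ (fun v w =>
    (m - 2) * g y (T v) w + τ * g y v w) (by intros; simp; ring) (by intros; simp; ring)
    (by intros; simp; ring) (by intros; simp; ring))
  simp only [LinearMap.mk₂_apply] at h1
  simp only [scalLocal, hg.ricciLocal_eq_of_curvature_eq hy hT hR, ← hτ, h1,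
    Finset.sum_add_distrib, ← Finset.mul_sum]
  have h2 := F.sum_self
  simp only [hg.symm y hy (dualVec g y _)] at h2 hτ
  rw [← hτ, h2, Fintype.card_fin]
  ring

namespace IsParacontactOn

variable {g : E m → E m →L[ℝ] E m →L[ℝ] ℝ} {φ : E m → E m →L[ℝ] E m} {ξ : E m → E m}
  {η : E m → E m →L[ℝ] ℝ} {Ω : Set (E m)} {y : E m}

theorem pTensor_eq (h : IsParacontactOn g φ ξ η Ω) (hy : y ∈ Ω) {X : E m} (hX : η y X = 0)
    (u w : E m) :
    pTensor g φ η y u w X = g y (nablaEnd g φ y u X + g y u X • ξ y) w := by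
  rw [pTensor, h.covDerivEnd_eq hy, hX, map_add, map_smul, add_apply, smul_apply, smul_eq_mul,
    h.symm y hy (ξ y), h.g_ξ hy]
  ring

theorem pNormSqLocal_eq (h : IsParacontactOn g φ ξ η Ω) (hy : y ∈ Ω) {X : E m} (hX : η y X = 0) :
    pNormSqLocal g φ η y X
      = ∑ a, g y (nablaEnd g φ y (basisVec a) X + g y (basisVec a) X • ξ y)
        (nablaEnd g φ y (dualVec g y a) X + g y (dualVec g y a) X • ξ y) := by
  have F := h.isDualFrame hy
  obtain ⟨L, hL⟩ : ∃ L : E m →L[ℝ] E m, ∀ u, nablaEnd g φ y u X + g y u X • ξ y = L u :=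
    ⟨(nablaEnd g φ y).flip X + ((g y).flip X).smulRight (ξ y), fun u => by simp⟩
  have h1 : ∀ p q, ∑ s, ∑ b, inverseMetric g y s b * (g y (L p) (basisVec s) *
      g y (L q) (basisVec b)) = g y (L p) (L q) := fun p q => by
    rw [← F.sum_inner_mul_inner]
    have h3 := IsMetricOn.sum_inverseMetric (g := g) y (LinearMap.mk₂ ℝ
      (fun v w => g y (L p) v * g y (L q) w) (by intros; simp; ring) (by intros; simp; ring)
      (by intros; simp; ring) (by intros; simp; ring))
    simpa only [LinearMap.mk₂_apply] using h3
  have h2 := IsMetricOn.sum_inverseMetric (g := g) y (LinearMap.mk₂ ℝ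
      (fun v w => g y (L v) (L w)) (by simp) (by simp) (by simp) (by simp))
  simp only [LinearMap.mk₂_apply] at h2
  simp only [hL, ← h2, pNormSqLocal, h.pTensor_eq hy hX]
  refine Finset.sum_congr rfl fun r _ => ?_
  rw [Finset.sum_comm]
  refine Finset.sum_congr rfl fun a _ => ?_
  rw [← h1, Finset.mul_sum]
  refine Finset.sum_congr rfl fun s _ => ?_
  rw [Finset.mul_sum]
  exact Finset.sum_congr rfl fun b _ => by ring

/-- The Ricci curvature formula for a conformally flat paracontact metric, in coordinates. -/
theorem ricciLocal_sub (h : IsParacontactOn g φ ξ η Ω) (hy : y ∈ Ω) {u : E m → ℝ}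
    (hu : ContDiffOn ℝ ∞ u Ω) (hpos : ∀ x ∈ Ω, 0 < u x)
    (hflat : ∀ v w z, curvature (fun x => u x • g x) y v w z = 0) {n : ℕ} (hn : 2 ≤ n)
    (hm : m = 2 * n + 1) {X : E m} (hXX : g y X X = 1) (hXξ : g y X (ξ y) = 0) :
    ricciLocal g y X X - ricciLocal g y (φ y X) (φ y X)
      = -4 * (n : ℝ) - 1 / ((n : ℝ) * (2 * (n : ℝ) - 3))
          * (2 * (n : ℝ) * (2 * (n : ℝ) + 1) + scalLocal g y)
        + (2 * (n : ℝ) - 1) / (2 * (n : ℝ) - 3)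
          * (pNormSqLocal g φ η y X + g y (hLocal φ ξ y X) (hLocal φ ξ y X)) := by
  have J := h.jet hy
  have F := h.isDualFrame hy
  have hX : η y X = 0 := by rw [← h.g_ξ hy, hXξ]
  obtain ⟨T, hT, hR⟩ := h.exists_curvature_eq_of_conformallyFlat hy hu hpos hflat
  have h1 := J.ricci_sub_of_secondDeriv F hT hR (h.g_nablaSqEnd_skew hy) (h.g_nablaSqEnd_cyclic hy)
    (h.nablaSqEnd_sub hy) (h.sum_g_nablaSqEnd hy) hX hXX (h.g_nablaSqEnd_φ hy hX)
  rw [J.sum_N_sub_sum_A F hX hXX (h.g_hLocal hy X), ← h.pNormSqLocal_eq hy hX,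
    ← h.ricciLocal_eq hy, ← h.ricciLocal_eq hy, Fintype.card_fin] at h1
  have h2 := h.ricciLocal_eq_of_curvature_eq hy hT hR X X
  have h3 := h.ricciLocal_eq_of_curvature_eq hy hT hR (φ y X) (φ y X)
  have h4 := h.scalLocal_eq_of_curvature_eq hy hT hR
  rw [h.g_φ_φ y hy, hX, hXX] at h3
  rw [hXX] at h2
  have hn' : (2 : ℝ) ≤ n := by exact_mod_cast hn
  have hn1 : 2 * (n : ℝ) - 3 ≠ 0 := by linarith
  have hn0 : (n : ℝ) ≠ 0 := by linarith
  have hm' : (m : ℝ) = 2 * n + 1 := by rw [hm]; push_cast; ring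
  rw [hm'] at h1 h2 h3 h4
  have key : (n : ℝ) * (2 * n - 3) * (ricciLocal g y X X - ricciLocal g y (φ y X) (φ y X))
      = n * (2 * n - 1) * (pNormSqLocal g φ η y X + g y (hLocal φ ξ y X) (hLocal φ ξ y X)
        + 2 - 4 * n) - scalLocal g y := by
    linear_combination -(n * (2 * n - 1) : ℝ) * h1 - 2 * (n : ℝ) * h2 + 2 * (n : ℝ) * h3 + h4
  obtain ⟨c, hc⟩ : ∃ c : ℝ, c = 2 * n - 3 := ⟨_, rfl⟩
  rw [← hc] at key hn1 ⊢
  field_simp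
  rw [hc] at key ⊢
  linear_combination key

/-- On a paraSasakian manifold `h = 0` and `P = 0`, the latter in the form
`(∇_u φ) v = η(v) u - g(u, v) ξ`. The Nijenhuis tensor does not depend on the coordinate `t` of the
product, so `t = 0` suffices. -/
theorem normal (h : IsParacontactOn g φ ξ η Ω) (hy : y ∈ Ω)
    (hJ : ∀ u w, nijenhuis (productJ φ ξ η) (y, 0) u w = 0) :
    (∀ v, hLocal φ ξ y v = 0) ∧ ∀ u v, nablaEnd g φ y u v = η y v • u - g y u v • ξ y := by
  have hφd := h.differentiableAt_φ hy
  have hηd := h.differentiableAt_η hy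
  have hξd := h.differentiableAt_ξ hy
  have J := h.jet hy
  have hD : ∀ u a : E m × ℝ, fderiv ℝ (fun z => productJ φ ξ η z u) (y, 0) a
      = (fderiv ℝ φ y a.1 u.1 + u.2 • fderiv ℝ ξ y a.1, fderiv ℝ η y a.1 u.1) := fun u a => by
    have h1 : (fun z => productJ φ ξ η z u)
        = (fun x => (φ x u.1 + u.2 • ξ x, η x u.1)) ∘ Prod.fst := rfl
    rw [h1, fderiv_comp _ (by fun_prop) (by fun_prop), DifferentiableAt.fderiv_prodMk (by fun_prop)
      (by fun_prop), fderiv_fun_add (by fun_prop) (by fun_prop), fderiv_fun_const_smul (by fun_prop)]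
    simp [fderiv_fst, fderiv_clm_apply_const hφd, fderiv_clm_apply_const hηd]
  -- the component of the Nijenhuis tensor on `(v, 0)` and `∂_t`
  have hh : ∀ v, hLocal φ ξ y v = 0 := fun v => by
    have h1 := congrArg Prod.fst (hJ (v, 0) (0, 1))
    simp only [nijenhuis, lieBracket, hD] at h1
    simp [productJ] at h1
    rw [hLocal, lieBracket, lieBracket, fderiv_clm_apply_const hφd]
    simp only [fderiv_fun_const, Pi.zero_apply, zero_apply, zero_sub, map_neg]
    rw [← smul_zero (-(1 / 2) : ℝ), ← h1]
    module
  refine ⟨hh, J.N_eq_of_normal (fun x z => ?_) fun v w => ?_⟩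
  · have := h.g_hLocal hy x z
    rw [hh] at this
    simp only [map_zero, zero_apply] at this
    linarith
  · have h1 := congrArg Prod.fst (hJ (v, 0) (w, 0))
    simp only [nijenhuis, lieBracket, hD] at h1
    simp [productJ] at h1
    have h2 := h.paracontact y hy v w
    rw [dOneForm] at h2
    rw [h2, ← h1]
    simp only [nablaEnd_apply, map_add, map_sub]
    rw [h.leviCivita_comm hy (φ y w) (φ y v), h.leviCivita_comm hy (φ y v) w,
      h.leviCivita_comm hy (φ y w) v, h.leviCivita_comm hy w v]
    module

end IsParacontactOn

end RicciFormula

/-! ### From the manifold to a chart -/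

theorem IsParacontactOn.mono {m : ℕ} {g : E m → E m →L[ℝ] E m →L[ℝ] ℝ} {φ : E m → E m →L[ℝ] E m}
    {ξ : E m → E m} {η : E m → E m →L[ℝ] ℝ} {Ω Ω' : Set (E m)}
    (h : IsParacontactOn g φ ξ η Ω) (hΩ' : IsOpen Ω') (hsub : Ω' ⊆ Ω) :
    IsParacontactOn g φ ξ η Ω' where
  isOpen := hΩ'
  smooth := h.smooth.mono hsub
  symm x hx := h.symm x (hsub hx)
  nondegenerate x hx := h.nondegenerate x (hsub hx)
  smooth_φ := h.smooth_φ.mono hsub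
  smooth_ξ := h.smooth_ξ.mono hsub
  smooth_η := h.smooth_η.mono hsub
  φ_ξ x hx := h.φ_ξ x (hsub hx)
  η_φ x hx := h.η_φ x (hsub hx)
  η_ξ x hx := h.η_ξ x (hsub hx)
  φ_sq x hx := h.φ_sq x (hsub hx)
  g_φ_φ x hx := h.g_φ_φ x (hsub hx)
  paracontact x hx := h.paracontact x (hsub hx)

theorem vecRep_eq {m : ℕ} {M : Type*} [TopologicalSpace M] [ChartedSpace (E m) M]
    {e : OpenPartialHomeomorph M (E m)} {y : E m} {q : M} (ξ : ∀ p : M, TangentSpace (𝓡 m) p)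
    (hq : e.symm y = q) : vecRep ξ e y = components e q (ξ q) := by
  subst hq
  rfl

section Charts

variable {m : ℕ} {M : Type*} [TopologicalSpace M] [ChartedSpace (E m) M] [IsManifold (𝓡 m) ∞ M]
  {e : OpenPartialHomeomorph M (E m)} {y : E m}

theorem components_frame (he : e ∈ atlas (E m) M) (hy : y ∈ e.target) (v : E m) :
    components e (e.symm y) (frame e y v) = v := by
  have : IsManifold (𝓡 m) 1 M := IsManifold.of_le (n := ∞) (by simp)
  have h := (mdifferentiable_of_mem_atlas (I := 𝓡 m) he).comp_symm_deriv hy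
  exact congrArg (fun L : E m →L[ℝ] E m => L v) h

theorem frame_components (he : e ∈ atlas (E m) M) (hy : y ∈ e.target)
    (X : TangentSpace (𝓡 m) (e.symm y)) : frame e y (components e (e.symm y) X) = X := by
  -- Both tangent spaces are copies of `ℝ^m`, so a surjection between them is injective.
  obtain ⟨L, hL⟩ : ∃ L : E m →ₗ[ℝ] E m, ∀ v, L v = components e (e.symm y) v :=
    ⟨(components e (e.symm y) : E m →L[ℝ] E m).toLinearMap, fun _ => rfl⟩
  have hsurj : Function.Surjective L :=
    fun v => ⟨frame e y v, (hL _).trans (components_frame he hy v)⟩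
  exact LinearMap.injective_iff_surjective.2 hsurj
    ((hL _).trans ((components_frame he hy _).trans (hL X).symm))

variable {q : M} (X Y : TangentSpace (𝓡 m) q)

theorem bilinRep_components
    (g : ∀ p : M, TangentSpace (𝓡 m) p →L[ℝ] TangentSpace (𝓡 m) p →L[ℝ] ℝ)
    (he : e ∈ atlas (E m) M) (hy : y ∈ e.target) (hq : e.symm y = q) :
    bilinRep g e y (components e q X) (components e q Y) = g q X Y := by
  subst hq
  change g _ (frame e y (components e _ X)) (frame e y (components e _ Y)) = _
  rw [frame_components he hy, frame_components he hy]

theorem endRep_components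
    (φ : ∀ p : M, TangentSpace (𝓡 m) p →L[ℝ] TangentSpace (𝓡 m) p)
    (he : e ∈ atlas (E m) M) (hy : y ∈ e.target) (hq : e.symm y = q) :
    endRep φ e y (components e q X) = components e q (φ q X) := by
  subst hq
  change components e _ (φ _ (frame e y (components e _ X))) = _
  rw [frame_components he hy]

end Charts

namespace AlmostParacontactMetric

variable {n : ℕ} {M : Type*} [TopologicalSpace M] [ChartedSpace (E (2 * n + 1)) M]
  [IsManifold (𝓡 (2 * n + 1)) ∞ M]

theorem isParacontactOn (S : AlmostParacontactMetric n M) (hS : S.IsParacontact)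
    {e : OpenPartialHomeomorph M (E (2 * n + 1))} (he : e ∈ atlas (E (2 * n + 1)) M) :
    IsParacontactOn (bilinRep S.g e) (endRep S.φ e) (vecRep S.ξ e) (formRep S.η e) e.target where
  isOpen := e.open_target
  smooth := S.smooth_g e he
  symm x hx v w := S.g_symm _ _ _
  nondegenerate x hx v hv := by
    have h1 : frame e x v = 0 := S.g_nondegenerate _ _ fun Y => by
      have h2 := hv (components e (e.symm x) Y)
      change S.g _ (frame e x v) (frame e x (components e _ Y)) = 0 at h2
      rwa [frame_components he hx] at h2
    rw [← components_frame he hx v, h1, map_zero]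
  smooth_φ := S.smooth_φ e he
  smooth_ξ := S.smooth_ξ e he
  smooth_η := S.smooth_η e he
  φ_ξ x hx := by
    rw [vecRep_eq S.ξ rfl, endRep_components _ S.φ he hx rfl, S.φ_ξ, map_zero]
  η_φ x hx v := by
    change S.η _ (frame e x (components e _ (S.φ _ (frame e x v)))) = 0
    rw [frame_components he hx, S.η_φ]
  η_ξ x hx := by
    change S.η _ (frame e x (components e _ (S.ξ _))) = 1
    rw [frame_components he hx, S.η_ξ]
  φ_sq x hx v := by
    change components e _ (S.φ _ (frame e x (components e _ (S.φ _ (frame e x v))))) = _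
    rw [frame_components he hx, S.φ_sq, map_sub, map_smul, components_frame he hx]
    rfl
  g_φ_φ x hx v w := by
    change S.g _ (frame e x (components e _ (S.φ _ (frame e x v))))
      (frame e x (components e _ (S.φ _ (frame e x w)))) = _
    rw [frame_components he hx, frame_components he hx, S.g_φ_φ]
    rfl
  paracontact x hx v w := hS e he x hx v w

theorem ricci_sub (S : AlmostParacontactMetric n M) (hn : 2 ≤ n)
    (hflat : IsLocallyConformallyFlat S.g) (hS : S.IsParacontact) (p : M)
    (X : TangentSpace (𝓡 (2 * n + 1)) p) (hXX : S.g p X X = 1) (hXξ : S.g p X (S.ξ p) = 0) :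
    ricci S.g p X X - ricci S.g p (S.φ p X) (S.φ p X)
      = -4 * (n : ℝ) - 1 / ((n : ℝ) * (2 * (n : ℝ) - 3))
          * (2 * (n : ℝ) * (2 * (n : ℝ) + 1) + scal S.g p)
        + (2 * (n : ℝ) - 1) / (2 * (n : ℝ) - 3) * (S.pNormSq p X + S.hNormSq p X) := by
  obtain ⟨U, hU, hpU, u, hu, hpos, hcurv⟩ := hflat p
  have he := chart_mem_atlas (E (2 * n + 1)) p
  have hp := mem_chart_source (E (2 * n + 1)) p
  have hy := (chartAt (E (2 * n + 1)) p).map_source hp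
  have hq := (chartAt (E (2 * n + 1)) p).left_inv hp
  have hΩ := (chartAt (E (2 * n + 1)) p).symm.isOpen_inter_preimage hU
  have h := (S.isParacontactOn hS he).mono hΩ Set.inter_subset_left
  have hu' : ContDiffOn ℝ ∞ (fun x => u ((chartAt (E (2 * n + 1)) p).symm x))
      ((chartAt (E (2 * n + 1)) p).target ∩ (chartAt (E (2 * n + 1)) p).symm ⁻¹' U) := by
    rw [← contMDiffOn_iff_contDiffOn]
    exact hu.comp ((contMDiffOn_symm_of_mem_maximalAtlas
      (IsManifold.subset_maximalAtlas he)).mono Set.inter_subset_left) fun x hx => hx.2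
  have hyΩ : chartAt (E (2 * n + 1)) p p ∈
      (chartAt (E (2 * n + 1)) p).target ∩ (chartAt (E (2 * n + 1)) p).symm ⁻¹' U :=
    ⟨hy, by rwa [Set.mem_preimage, hq]⟩
  have key := h.ricciLocal_sub (X := components _ p X) hyΩ hu' (fun x hx => hpos _ hx.2)
    (hcurv _ he _ hy hyΩ.2) hn rfl (by rw [bilinRep_components _ _ _ he hy hq, hXX])
    (by rw [vecRep_eq S.ξ hq, bilinRep_components _ _ _ he hy hq, hXξ])
  rw [endRep_components _ _ he hy hq] at key
  exact key

theorem IsParaSasakian.norms_eq_zero {S : AlmostParacontactMetric n M} (hS : S.IsParaSasakian)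
    (p : M) (X : TangentSpace (𝓡 (2 * n + 1)) p) (hXξ : S.g p X (S.ξ p) = 0) :
    S.pNormSq p X = 0 ∧ S.hNormSq p X = 0 := by
  have he := chart_mem_atlas (E (2 * n + 1)) p
  have hp := mem_chart_source (E (2 * n + 1)) p
  have hy := (chartAt (E (2 * n + 1)) p).map_source hp
  have hq := (chartAt (E (2 * n + 1)) p).left_inv hp
  have h := S.isParacontactOn hS.1 he
  obtain ⟨h1, h2⟩ := h.normal hy (hS.2 _ he _ hy 0)
  constructor
  · have hX : formRep S.η (chartAt (E (2 * n + 1)) p) (chartAt (E (2 * n + 1)) p p)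
        (components (chartAt (E (2 * n + 1)) p) p X) = 0 := by
      rw [← h.g_ξ hy, vecRep_eq S.ξ hq, bilinRep_components _ _ _ he hy hq, hXξ]
    rw [pNormSq, h.pNormSqLocal_eq hy hX]
    simp [h2, hX]
  · rw [hNormSq, hComponents, h1, map_zero]

end AlmostParacontactMetric

end Paracontact

theorem theoremt8 (n : ℕ) (hn : 5 ≤ 2 * n + 1) {M : Type*} [TopologicalSpace M]
    [ChartedSpace (Paracontact.E (2 * n + 1)) M] [IsManifold (𝓡 (2 * n + 1)) ∞ M]
    (S : Paracontact.AlmostParacontactMetric n M)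
    (hflat : Paracontact.IsLocallyConformallyFlat S.g) :
    (S.IsParacontact →
      ∀ (p : M) (X : TangentSpace (𝓡 (2 * n + 1)) p), S.g p X X = 1 → S.g p X (S.ξ p) = 0 →
        Paracontact.ricci S.g p X X - Paracontact.ricci S.g p (S.φ p X) (S.φ p X)
          = -4 * (n : ℝ)
            - 1 / ((n : ℝ) * (2 * (n : ℝ) - 3))
              * (2 * (n : ℝ) * (2 * (n : ℝ) + 1) + Paracontact.scal S.g p)
            + (2 * (n : ℝ) - 1) / (2 * (n : ℝ) - 3) * (S.pNormSq p X + S.hNormSq p X)) ∧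
    (S.IsParaSasakian →
      ∀ (p : M) (X : TangentSpace (𝓡 (2 * n + 1)) p), S.g p X X = 1 → S.g p X (S.ξ p) = 0 →
        Paracontact.ricci S.g p X X - Paracontact.ricci S.g p (S.φ p X) (S.φ p X)
          = -4 * (n : ℝ)
            - 1 / ((n : ℝ) * (2 * (n : ℝ) - 3))
              * (2 * (n : ℝ) * (2 * (n : ℝ) + 1) + Paracontact.scal S.g p)) := by
  refine ⟨fun hS p X hXX hXξ => S.ricci_sub (by omega) hflat hS p X hXX hXξ,
    fun hS p X hXX hXξ => ?_⟩
  obtain ⟨h1, h2⟩ := hS.norms_eq_zero p X hXξ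
  rw [S.ricci_sub (by omega) hflat hS.1 p X hXX hXξ, h1, h2, add_zero, mul_zero, add_zero]
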